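/- Let $r\ge 1$ and let $A,R,S$ be real $r\times r$ matrices with $R$ and $S$ symmetric positive semidefinite. Let $R^{1/2},S^{1/2}$ be symmetric square roots of $R,S$, and assume that $(A,S^{1/2})$ is observable and $(A,R^{1/2})$ is controllable. Let $\|\cdot\|$ denote the spectral norm, $\lambda_{\min}$ the smallest eigenvalue of a symmetric matrix, $M'$ the transpose of $M$, and $\Lambda(P)=AP+PA'+R-PSP$. There is a unique symmetric positive definite matrix $P_\infty$ such that $\Lambda(P_\infty)=0$ and all eigenvalues of $B:=A-P_\infty S$ have negative real part. Put $$\mathbb S_t=\int_0^t e^{sB'}Se^{sB}\,ds,\qquad \mathbb S_\infty=\int_0^\infty e^{sB'}Se^{sB}\,ds,\qquad P_\infty^-=P_\infty-\mathbb S_\infty^{-1},\qquad \mathbb C_t(Q)=I+(Q-P_\infty)\mathbb S_t .$$ Then $\mathbb S_t$ is positive definite for every $t>0$, $\mathbb S_t\to\mathbb S_\infty$ as $t\to\infty$, $\mathbb S_\infty$ is positive definite, $P_\infty^-$ is the unique negative definite solution of $\Lambda(P)=0$, and $\mathbb C_t(P_\infty)=I$ for all $t\ge0$. Let $Q$ be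 symmetric positive semidefinite. The Riccati equation $\partial_t\phi_t(Q)=\Lambda(\phi_t(Q))$, $\phi_0(Q)=Q$, has a unique solution on $[0,\infty)$, and there are transition matrices $E_{s,t}(Q)$, $0\le s\le t$, with $E_{s,s}(Q)=I$, $\partial_tE_{s,t}(Q)=(A-\phi_t(Q)S)E_{s,t}(Q)$ and $\partial_sE_{s,t}(Q)=-E_{s,t}(Q)(A-\phi_s(Q)S)$. Write $E_t(Q)=E_{0,t}(Q)$. For every $t\ge0$ the matrix $\mathbb C_t(Q)$ is invertible and $$E_t(Q)=e^{tB}\,\mathbb C_t(Q)^{-1};$$ moreover $\mathbb C_t(Q)=\big[(\mathbb S_t^{-1}-\mathbb S_\infty^{-1})+(Q-P_\infty^-)\big]\mathbb S_t$ for $t>0$. With $$\chi_\delta=\big[\lambda_{\min}(\mathbb S_\delta)\,\lambda_{\min}(-P_\infty^-)\big]^{-1},\qquad \chi(Q)=\|(P_\infty^-)^{-1}\|\,\big[\|P_\infty-P_\infty^-\|+\|Q-P_\infty\|\big],$$ one has, for every $\delta>0$, $$\sup_{t\ge\delta}\|\mathbb C_t(Q)^{-1}\|\le\chi_\delta\quad\text{and}\quad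 \|E_t(Q)\|\le\chi_\delta\|e^{tB}\|\ \text{ for all } t\ge\delta,$$ $$\sup_{t\ge0}\|\mathbb C_t(Q)^{-1}\|\le\chi(Q)\quad\text{and}\quad \|E_t(Q)\|\le\chi(Q)\|e^{tB}\|\ \text{ for all } t\ge0 .$$ -/

import Mathlib

open Filter Topology Set MeasureTheory
open scoped Matrix Matrix.Norms.L2Operator

/-! Real `r × r` matrices carry the spectral (Euclidean operator) norm throughout. -/

noncomputable section

namespace Riccati

/-- `(A, C)` is controllable: the Kalman matrix `[C, A C, …, A^{r-1} C]` has rank `r`. -/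
def IsControllable {r m : ℕ} (A : Matrix (Fin r) (Fin r) ℝ) (C : Matrix (Fin r) (Fin m) ℝ) :
    Prop :=
  (Matrix.of fun (i : Fin r) (kj : Fin r × Fin m) => (A ^ (kj.1 : ℕ) * C) i kj.2).rank = r

/-- `(A, C)` is observable: the stacked Kalman matrix `[C; C A; …; C A^{r-1}]` has rank `r`. -/
def IsObservable {r m : ℕ} (A : Matrix (Fin r) (Fin r) ℝ) (C : Matrix (Fin m) (Fin r) ℝ) :
    Prop :=
  (Matrix.of fun (ki : Fin r × Fin m) (j : Fin r) => (C * A ^ (ki.1 : ℕ)) ki.2 j).rank = r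

/-- `H` is a symmetric square root of `M`. -/
def IsSymmSqrt {r : ℕ} (M H : Matrix (Fin r) (Fin r) ℝ) : Prop :=
  H.IsSymm ∧ H * H = M

/-- All complex eigenvalues of the real matrix `B` have negative real part. -/
def IsHurwitz {r : ℕ} (B : Matrix (Fin r) (Fin r) ℝ) : Prop :=
  ∀ z ∈ spectrum ℂ (B.map (algebraMap ℝ ℂ)), z.re < 0

/-- The smallest (real) eigenvalue; used for symmetric matrices only. -/
def lambdaMin {r : ℕ} (M : Matrix (Fin r) (Fin r) ℝ) : ℝ :=
  sInf (spectrum ℝ M)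

/-- The Riccati drift `Λ(P) = A P + P A' + R - P S P`. -/
def drift {r : ℕ} (A R S P : Matrix (Fin r) (Fin r) ℝ) : Matrix (Fin r) (Fin r) ℝ :=
  A * P + P * Aᵀ + R - P * S * P

/-- `P` is a positive definite fixed point of the Riccati equation for which `A - P S` is stable. -/
def IsStabilizingFixedPoint {r : ℕ} (A R S P : Matrix (Fin r) (Fin r) ℝ) : Prop :=
  P.PosDef ∧ drift A R S P = 0 ∧ IsHurwitz (A - P * S)

/-- `φ` solves the matrix Riccati equation on `[0, ∞)` with `φ 0 = Q`
(the derivative at `0` being one-sided). -/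
def IsRiccatiSolution {r : ℕ} (A R S Q : Matrix (Fin r) (Fin r) ℝ)
    (φ : ℝ → Matrix (Fin r) (Fin r) ℝ) : Prop :=
  φ 0 = Q ∧ ∀ t : ℝ, 0 ≤ t → HasDerivWithinAt φ (drift A R S (φ t)) (Ici 0) t

/-- `E s t`, `0 ≤ s ≤ t`, is the family of state transition matrices generated by the
time-dependent matrix `t ↦ A - φ t S`. -/
def IsTransitionMatrix {r : ℕ} (A S : Matrix (Fin r) (Fin r) ℝ)
    (φ : ℝ → Matrix (Fin r) (Fin r) ℝ) (E : ℝ → ℝ → Matrix (Fin r) (Fin r) ℝ) : Prop :=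
  (∀ s : ℝ, 0 ≤ s → E s s = 1) ∧
  (∀ s t : ℝ, 0 ≤ s → s ≤ t →
    HasDerivWithinAt (fun u => E s u) ((A - φ t * S) * E s t) (Ici s) t) ∧
  (∀ s t : ℝ, 0 ≤ s → s ≤ t →
    HasDerivWithinAt (fun u => E u t) (-(E s t * (A - φ s * S))) (Icc 0 t) s)

/-- The integrand `e^{sB'} S e^{sB}`. -/
def gramIntegrand {r : ℕ} (B S : Matrix (Fin r) (Fin r) ℝ) (s : ℝ) :
    Matrix (Fin r) (Fin r) ℝ :=
  NormedSpace.exp (s • Bᵀ) * S * NormedSpace.exp (s • B)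

/-- The Gramian `S_t = ∫_0^t e^{sB'} S e^{sB} ds`. -/
def gram {r : ℕ} (B S : Matrix (Fin r) (Fin r) ℝ) (t : ℝ) : Matrix (Fin r) (Fin r) ℝ :=
  ∫ s in (0 : ℝ)..t, gramIntegrand B S s

/-- The limiting Gramian `S_∞ = ∫_0^∞ e^{sB'} S e^{sB} ds`. -/
def gramInf {r : ℕ} (B S : Matrix (Fin r) (Fin r) ℝ) : Matrix (Fin r) (Fin r) ℝ :=
  ∫ s in Ioi (0 : ℝ), gramIntegrand B S s

/-- `C_t(Q) = I + (Q - P) S_t`, where `S_t` is the Gramian for `B = A - P S`. -/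
def floquetC {r : ℕ} (A S P : Matrix (Fin r) (Fin r) ℝ) (t : ℝ)
    (Q : Matrix (Fin r) (Fin r) ℝ) : Matrix (Fin r) (Fin r) ℝ :=
  1 + (Q - P) * gram (A - P * S) S t

/-- `P⁻ = P - S_∞⁻¹`, where `S_∞` is the limiting Gramian for `B = A - P S`. -/
def negPoint {r : ℕ} (A S P : Matrix (Fin r) (Fin r) ℝ) : Matrix (Fin r) (Fin r) ℝ :=
  P - (gramInf (A - P * S) S)⁻¹

/-- `χ_δ = [λ_min(S_δ) λ_min(-P⁻)]⁻¹`. -/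
def chiDelta {r : ℕ} (A S P : Matrix (Fin r) (Fin r) ℝ) (δ : ℝ) : ℝ :=
  (lambdaMin (gram (A - P * S) S δ) * lambdaMin (-negPoint A S P))⁻¹

/-- `χ(Q) = ‖(P⁻)⁻¹‖ (‖P - P⁻‖ + ‖Q - P‖)`. -/
def chi {r : ℕ} (A S P Q : Matrix (Fin r) (Fin r) ℝ) : ℝ :=
  ‖(negPoint A S P)⁻¹‖ * (‖P - negPoint A S P‖ + ‖Q - P‖)

end Riccati

end

open Riccati

/-!
The mechanism is the Lyapunov equation `F' X + X F + Q = 0`. Along its solutions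
`e^{tF'} X e^{tF} = X - S_t`, where `S_t` is the Gramian of `(F, Q)` (`gramIntegrand_of_lyapunov`).
So a positive definite `X` with `Q ≥ 0` and `(F, Q)` observable forces exponential decay of `e^{tF}`
(`expStable_of_lyapunov`); conversely, if `F` is stable the solution is unique and equals the
limiting Gramian (`ExpStable.eq_gramInf`), which is positive definite under observability
(`posDef_of_lyapunov`). Observability is used in the form "only zero has an entirely vanishing
output", which is insensitive to feedback (`ObservablePair.of_feedback`).

The equation `Λ(P) = 0` is a Lyapunov equation for the closed loop `B = A - P S`, with right-hand
side `R + P S P`. Hence every positive definite solution is stabilizing and every negative definite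
one is stabilizing for the reversed flow; as the difference of two solutions solves a homogeneous
Sylvester equation in the two closed loops, each kind is unique. The positive definite solution is
the limit of Newton's method for `Λ` (`newtonStep`), started from a gain that the Gramian of
the time-reversed system provides: each step solves a Lyapunov equation, keeps the closed loop
stable, and decreases from the first step on. Given `P`, the Lyapunov equation of `S_∞` says that
`P⁻ = P - S_∞⁻¹` is again a solution, and that `S_∞` is a Lyapunov function for the reversed closed
loop at `P⁻`, so that `-P⁻` is itself a limiting Gramian and positive definite.

For the estimates, `C_t(Q) = W_t S_t` with `W_t = (S_t⁻¹ - S_∞⁻¹) + (Q - P⁻) ≥ -P⁻ > 0`, because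
`S_t ≤ S_∞`. This gives invertibility, and `C_t(Q)⁻¹ = S_t⁻¹ W_t⁻¹ = I - (Q - P) W_t⁻¹` gives the
two bounds. Since `C_t(Q)` is invertible for all `t ≥ 0`, the matrices `U_t = e^{tB} C_t(Q)⁻¹` and
`φ_t = P + U_t (Q - P) e^{tB'}` are defined for all times, and differentiation shows that they solve
`U' = (A - φ S) U` and the Riccati equation. Uniqueness for linear differential equations identifies
every solution with `φ` and every transition matrix `E_{0,t}` with `U_t`.
-/

namespace Riccati

variable {r : ℕ} {A R S M N F G Q X Y P : Matrix (Fin r) (Fin r) ℝ}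

/-! ### Quadratic forms and the spectral norm -/

lemma posSemidef_iff_quad :
    M.PosSemidef ↔ M.IsSymm ∧ ∀ x : Fin r → ℝ, 0 ≤ x ⬝ᵥ M *ᵥ x := by
  rw [Matrix.posSemidef_iff_dotProduct_mulVec]
  simp [Matrix.IsHermitian, Matrix.IsSymm, Matrix.conjTranspose_eq_transpose_of_trivial]

lemma symm_of_posSemidef (h : M.PosSemidef) : M.IsSymm := (posSemidef_iff_quad.1 h).1

lemma quad_nonneg (h : M.PosSemidef) (x : Fin r → ℝ) : 0 ≤ x ⬝ᵥ M *ᵥ x :=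
  (posSemidef_iff_quad.1 h).2 x

lemma mulVec_eq_zero_of_quad (h : M.PosSemidef) {x : Fin r → ℝ} (hx : x ⬝ᵥ M *ᵥ x = 0) :
    M *ᵥ x = 0 :=
  (h.dotProduct_mulVec_zero_iff x).1 (by simpa using hx)

lemma posDef_of_ker (h : M.PosSemidef) (hk : ∀ x, M *ᵥ x = 0 → x = 0) : M.PosDef := by
  refine Matrix.PosDef.of_dotProduct_mulVec_pos h.1 fun x hx => ?_
  simp only [star_trivial]
  exact lt_of_le_of_ne (quad_nonneg h x) fun h0 => hx (hk x (mulVec_eq_zero_of_quad h h0.symm))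

lemma mulVec_injective_of_posDef (h : M.PosDef) {x : Fin r → ℝ} (hx : M *ᵥ x = 0) : x = 0 := by
  by_contra hne
  have := h.dotProduct_mulVec_pos hne
  simp [hx] at this

/-- Both summands of a sum of positive semidefinite matrices vanish on its kernel. -/
lemma mulVec_eq_zero_of_add (hM : M.PosSemidef) (hN : N.PosSemidef) {x : Fin r → ℝ}
    (hx : (M + N) *ᵥ x = 0) : M *ᵥ x = 0 ∧ N *ᵥ x = 0 := by
  have h1 := quad_nonneg hM x
  have h2 := quad_nonneg hN x
  have h : x ⬝ᵥ M *ᵥ x + x ⬝ᵥ N *ᵥ x = 0 := by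
    rw [← dotProduct_add, ← Matrix.add_mulVec, hx, dotProduct_zero]
  exact ⟨mulVec_eq_zero_of_quad hM (by linarith), mulVec_eq_zero_of_quad hN (by linarith)⟩

lemma dotProduct_transpose_mul_mul (x : Fin r → ℝ) (M N : Matrix (Fin r) (Fin r) ℝ) :
    x ⬝ᵥ (Nᵀ * M * N) *ᵥ x = (N *ᵥ x) ⬝ᵥ M *ᵥ (N *ᵥ x) := by
  rw [← Matrix.mulVec_mulVec, ← Matrix.mulVec_mulVec, Matrix.dotProduct_mulVec,
    Matrix.vecMul_transpose]

lemma posSemidef_transpose_mul_mul (hM : M.PosSemidef) (N : Matrix (Fin r) (Fin r) ℝ) :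
    (Nᵀ * M * N).PosSemidef := by
  simpa [Matrix.conjTranspose_eq_transpose_of_trivial] using hM.conjTranspose_mul_mul_same N

lemma dotProduct_self_eq_norm_sq (x : Fin r → ℝ) : x ⬝ᵥ x = ‖WithLp.toLp 2 x‖ ^ 2 := by
  rw [EuclideanSpace.real_norm_sq_eq]
  simp [dotProduct, pow_two]

lemma norm_mulVec_le (M : Matrix (Fin r) (Fin r) ℝ) (x : Fin r → ℝ) :
    ‖WithLp.toLp 2 (M *ᵥ x)‖ ≤ ‖M‖ * ‖WithLp.toLp 2 x‖ :=
  Matrix.l2_opNorm_mulVec M (WithLp.toLp 2 x)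

lemma norm_le_of_mulVec {C : ℝ} (hC : 0 ≤ C)
    (h : ∀ x : Fin r → ℝ, ‖WithLp.toLp 2 (M *ᵥ x)‖ ≤ C * ‖WithLp.toLp 2 x‖) : ‖M‖ ≤ C := by
  rw [Matrix.cstar_norm_def]
  exact ContinuousLinearMap.opNorm_le_bound _ hC fun x => h x.ofLp

lemma quad_le_norm (M : Matrix (Fin r) (Fin r) ℝ) (x : Fin r → ℝ) :
    x ⬝ᵥ M *ᵥ x ≤ ‖M‖ * (x ⬝ᵥ x) := by
  have h : x ⬝ᵥ M *ᵥ x = inner ℝ (WithLp.toLp 2 x) (WithLp.toLp 2 (M *ᵥ x)) := by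
    simp [PiLp.inner_apply, dotProduct, mul_comm]
  rw [h, dotProduct_self_eq_norm_sq]
  refine (real_inner_le_norm _ _).trans ?_
  nlinarith [norm_mulVec_le M x, norm_nonneg (WithLp.toLp 2 x)]

lemma norm_transpose (M : Matrix (Fin r) (Fin r) ℝ) : ‖Mᵀ‖ = ‖M‖ := by
  rw [← Matrix.conjTranspose_eq_transpose_of_trivial, Matrix.l2_opNorm_conjTranspose]

/-- A lower bound of the quadratic form bounds the inverse. -/
lemma norm_inv_le {m : ℝ} (hm : 0 < m) (h : ∀ x : Fin r → ℝ, m * (x ⬝ᵥ x) ≤ x ⬝ᵥ M *ᵥ x)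
    (hM : IsUnit M) : ‖M⁻¹‖ ≤ m⁻¹ := by
  refine norm_le_of_mulVec (inv_nonneg.2 hm.le) fun x => ?_
  set y := M⁻¹ *ᵥ x with hy
  have hMy : M *ᵥ y = x := by
    rw [hy, Matrix.mulVec_mulVec, Matrix.mul_nonsing_inv _ ((Matrix.isUnit_iff_isUnit_det _).1 hM),
      Matrix.one_mulVec]
  have h1 := h y
  have h2 : y ⬝ᵥ x ≤ ‖WithLp.toLp 2 y‖ * ‖WithLp.toLp 2 x‖ := by
    have h : y ⬝ᵥ x = inner ℝ (WithLp.toLp 2 y) (WithLp.toLp 2 x) := by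
      simp [PiLp.inner_apply, dotProduct, mul_comm]
    rw [h]; exact real_inner_le_norm _ _
  rw [hMy, dotProduct_self_eq_norm_sq] at h1
  rw [le_inv_mul_iff₀ hm]
  rcases (norm_nonneg (WithLp.toLp 2 y)).eq_or_lt with h0 | h0
  · rw [← h0]; simp
  · refine le_of_mul_le_mul_left ?_ h0
    nlinarith

/-! ### The smallest eigenvalue -/

lemma lambdaMin_mul_le (hM : M.IsSymm) (x : Fin r → ℝ) :
    lambdaMin M * (x ⬝ᵥ x) ≤ x ⬝ᵥ M *ᵥ x := by
  open scoped MatrixOrder in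
  have hsa : IsSelfAdjoint M := by
    rw [IsSelfAdjoint, Matrix.star_eq_conjTranspose,
      Matrix.conjTranspose_eq_transpose_of_trivial]; exact hM
  open scoped MatrixOrder in
  have h : algebraMap ℝ _ (lambdaMin M) ≤ M :=
    algebraMap_le_of_le_spectrum (fun x hx =>
      csInf_le (spectrum.isCompact (𝕜 := ℝ) M).bddBelow hx) hsa
  have h' := quad_nonneg (Matrix.le_iff.1 h) x
  rw [Matrix.sub_mulVec, dotProduct_sub, Algebra.algebraMap_eq_smul_one, Matrix.smul_mulVec,
    Matrix.one_mulVec, dotProduct_smul, smul_eq_mul] at h'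
  linarith

lemma spectrum_nonempty_of_symm (hr : 1 ≤ r) (hM : M.IsSymm) : (spectrum ℝ M).Nonempty := by
  have hH : M.IsHermitian := by
    rw [Matrix.IsHermitian, Matrix.conjTranspose_eq_transpose_of_trivial]; exact hM
  rw [hH.spectrum_real_eq_range_eigenvalues]
  exact ⟨_, ⟨0, hr⟩, rfl⟩

lemma exists_eigenvector {μ : ℝ} (hμ : μ ∈ spectrum ℝ M) :
    ∃ x : Fin r → ℝ, x ≠ 0 ∧ M *ᵥ x = μ • x := by
  rw [← Matrix.spectrum_toLin', ← Module.End.hasEigenvalue_iff_mem_spectrum] at hμ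
  obtain ⟨x, hx⟩ := hμ.exists_hasEigenvector
  exact ⟨x, hx.2, by simpa using hx.apply_eq_smul⟩

lemma lambdaMin_pos (hr : 1 ≤ r) (hM : M.PosDef) : 0 < lambdaMin M := by
  have hs := symm_of_posSemidef hM.posSemidef
  have := (spectrum.isCompact (𝕜 := ℝ) M).sInf_mem (spectrum_nonempty_of_symm hr hs)
  obtain ⟨x, hx0, hx⟩ := exists_eigenvector this
  have h1 := hM.dotProduct_mulVec_pos hx0
  have h2 : 0 < x ⬝ᵥ x := by simpa using Matrix.dotProduct_star_self_pos_iff.2 hx0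
  rw [hx, star_trivial, dotProduct_smul, smul_eq_mul] at h1
  exact pos_of_mul_pos_left h1 h2.le

lemma exists_pos_mul_le_quad (hM : M.PosDef) :
    ∃ a : ℝ, 0 < a ∧ ∀ x : Fin r → ℝ, a * (x ⬝ᵥ x) ≤ x ⬝ᵥ M *ᵥ x := by
  rcases Nat.eq_zero_or_pos r with rfl | hr
  · exact ⟨1, one_pos, fun x => by simp [dotProduct]⟩
  · exact ⟨_, lambdaMin_pos hr hM,
      lambdaMin_mul_le (symm_of_posSemidef hM.posSemidef)⟩

lemma inv_norm_inv_mul_le_quad (hM : M.PosDef) (x : Fin r → ℝ) :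
    ‖M⁻¹‖⁻¹ * (x ⬝ᵥ x) ≤ x ⬝ᵥ M *ᵥ x := by
  rcases Nat.eq_zero_or_pos r with rfl | hr
  · simp [dotProduct]
  have hs := symm_of_posSemidef hM.posSemidef
  have hpos := lambdaMin_pos hr hM
  refine le_trans ?_ (lambdaMin_mul_le hs x)
  refine mul_le_mul_of_nonneg_right ?_ (by simpa using dotProduct_star_self_nonneg x)
  obtain ⟨y, hy0, hy⟩ := exists_eigenvector
    ((spectrum.isCompact (𝕜 := ℝ) M).sInf_mem (spectrum_nonempty_of_symm hr hs))
  change M *ᵥ y = lambdaMin M • y at hy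
  -- `y` is an eigenvector of the inverse for the inverse eigenvalue
  have hinv : y = lambdaMin M • (M⁻¹ *ᵥ y) := by
    rw [← Matrix.mulVec_smul, ← hy, Matrix.mulVec_mulVec,
      Matrix.nonsing_inv_mul _ ((Matrix.isUnit_iff_isUnit_det _).1 hM.isUnit), Matrix.one_mulVec]
  have hyn : 0 < ‖WithLp.toLp 2 y‖ := by simpa using hy0
  have h1 : ‖WithLp.toLp 2 y‖ ≤ lambdaMin M * (‖M⁻¹‖ * ‖WithLp.toLp 2 y‖) := by
    conv_lhs => rw [hinv, WithLp.toLp_smul, norm_smul, Real.norm_of_nonneg hpos.le]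
    exact mul_le_mul_of_nonneg_left (norm_mulVec_le _ _) hpos.le
  have h2 : 1 ≤ lambdaMin M * ‖M⁻¹‖ := by
    refine le_of_mul_le_mul_right ?_ hyn
    linarith
  have h3 : 0 < ‖M⁻¹‖ := pos_of_mul_pos_right (one_pos.trans_le h2) hpos.le
  rwa [inv_le_iff_one_le_mul₀ h3]

/-! ### Matrix exponentials and Gramians -/

lemma exp_smul_transpose (F : Matrix (Fin r) (Fin r) ℝ) (t : ℝ) :
    NormedSpace.exp (t • Fᵀ) = (NormedSpace.exp (t • F))ᵀ := by
  rw [← Matrix.transpose_smul, Matrix.exp_transpose]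

lemma gramIntegrand_eq (F Q : Matrix (Fin r) (Fin r) ℝ) (t : ℝ) :
    gramIntegrand F Q t = (NormedSpace.exp (t • F))ᵀ * Q * NormedSpace.exp (t • F) := by
  rw [gramIntegrand, exp_smul_transpose]

lemma gramIntegrand_zero (F Q : Matrix (Fin r) (Fin r) ℝ) : gramIntegrand F Q 0 = Q := by
  simp [gramIntegrand]

lemma hasDerivAt_exp (F : Matrix (Fin r) (Fin r) ℝ) (t : ℝ) :
    HasDerivAt (fun s : ℝ => NormedSpace.exp (s • F)) (F * NormedSpace.exp (t • F)) t :=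
  hasDerivAt_exp_smul_const' F t

/-- Conjugation by the exponential flow turns the Lyapunov operator into differentiation. -/
lemma hasDerivAt_gramIntegrand (F X : Matrix (Fin r) (Fin r) ℝ) (t : ℝ) :
    HasDerivAt (gramIntegrand F X) (gramIntegrand F (Fᵀ * X + X * F) t) t := by
  have h := ((hasDerivAt_exp_smul_const Fᵀ t).mul_const X).mul (hasDerivAt_exp F t)
  refine h.congr_deriv ?_
  simp only [gramIntegrand]
  noncomm_ring

lemma continuous_gramIntegrand (F Q : Matrix (Fin r) (Fin r) ℝ) :
    Continuous (gramIntegrand F Q) :=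
  continuous_iff_continuousAt.2 fun t => (hasDerivAt_gramIntegrand F Q t).continuousAt

lemma hasDerivAt_gram (F Q : Matrix (Fin r) (Fin r) ℝ) (t : ℝ) :
    HasDerivAt (gram F Q) (gramIntegrand F Q t) t :=
  (continuous_gramIntegrand F Q).integral_hasStrictDerivAt 0 t |>.hasDerivAt

lemma gram_zero (F Q : Matrix (Fin r) (Fin r) ℝ) : gram F Q 0 = 0 := by
  simp [gram]

lemma gram_lyapunov (F X : Matrix (Fin r) (Fin r) ℝ) (t : ℝ) :
    gram F (Fᵀ * X + X * F) t = gramIntegrand F X t - X := by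
  rw [gram, intervalIntegral.integral_eq_sub_of_hasDerivAt
    (fun s _ => hasDerivAt_gramIntegrand F X s)
    ((continuous_gramIntegrand F _).intervalIntegrable _ _), gramIntegrand_zero]

lemma gramIntegrand_neg (F Q : Matrix (Fin r) (Fin r) ℝ) (t : ℝ) :
    gramIntegrand F (-Q) t = -gramIntegrand F Q t := by
  simp [gramIntegrand]

lemma gram_neg (F Q : Matrix (Fin r) (Fin r) ℝ) (t : ℝ) : gram F (-Q) t = -gram F Q t := by
  simp [gram, gramIntegrand_neg]

/-- A solution of the Lyapunov equation is the Gramian up to its own transport by the flow. -/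
lemma gramIntegrand_of_lyapunov (h : Fᵀ * X + X * F + Q = 0) (t : ℝ) :
    gramIntegrand F X t = X - gram F Q t := by
  have := gram_lyapunov F X t
  rw [eq_neg_of_add_eq_zero_left h, gram_neg] at this
  rw [eq_add_of_sub_eq this.symm]; abel

lemma gram_mul (F Q : Matrix (Fin r) (Fin r) ℝ) (t : ℝ) :
    Fᵀ * gram F Q t + gram F Q t * F = gramIntegrand F Q t - Q := by
  rw [← gram_lyapunov]
  have hi := (continuous_gramIntegrand F Q).intervalIntegrable (μ := volume) 0 t
  have hc : ∀ s, gramIntegrand F (Fᵀ * Q + Q * F) s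
      = Fᵀ * gramIntegrand F Q s + gramIntegrand F Q s * F := fun s => by
    have h1 : Commute Fᵀ (NormedSpace.exp (s • Fᵀ)) :=
      ((Commute.refl Fᵀ).smul_right s).exp_right
    have h2 : Commute F (NormedSpace.exp (s • F)) := ((Commute.refl F).smul_right s).exp_right
    simp only [gramIntegrand, mul_add, add_mul, ← mul_assoc, h1.eq]
    simp only [mul_assoc, h2.eq]
  simp only [gram, hc]
  have hl := (ContinuousLinearMap.mul ℝ _ Fᵀ).intervalIntegral_comp_comm hi
  have hr := ((ContinuousLinearMap.mul ℝ _).flip F).intervalIntegral_comp_comm hi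
  simp only [ContinuousLinearMap.mul_apply', ContinuousLinearMap.flip_apply] at hl hr
  rw [intervalIntegral.integral_add, hl, hr]
  · exact ((continuous_gramIntegrand F Q).const_mul Fᵀ).intervalIntegrable _ _
  · exact ((continuous_gramIntegrand F Q).mul_const F).intervalIntegrable _ _

/-- Evaluation of the quadratic form at a vector, as a continuous linear functional of the
matrix. -/
noncomputable def quadCLM (x : Fin r → ℝ) : Matrix (Fin r) (Fin r) ℝ →L[ℝ] ℝ :=
  LinearMap.toContinuousLinearMap
    { toFun := fun M => x ⬝ᵥ M *ᵥ x
      map_add' := fun M N => by rw [Matrix.add_mulVec, dotProduct_add]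
      map_smul' := fun c M => by simp [Matrix.smul_mulVec] }

lemma continuous_quad {f : ℝ → Matrix (Fin r) (Fin r) ℝ} (hf : Continuous f) (x : Fin r → ℝ) :
    Continuous fun t => x ⬝ᵥ f t *ᵥ x :=
  (quadCLM x).continuous.comp hf

lemma quad_gram (F Q : Matrix (Fin r) (Fin r) ℝ) (t : ℝ) (x : Fin r → ℝ) :
    x ⬝ᵥ gram F Q t *ᵥ x = ∫ s in (0 : ℝ)..t, x ⬝ᵥ gramIntegrand F Q s *ᵥ x :=
  ((quadCLM x).intervalIntegral_comp_comm
    ((continuous_gramIntegrand F Q).intervalIntegrable 0 t)).symm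

lemma posSemidef_gramIntegrand (hQ : Q.PosSemidef) (F : Matrix (Fin r) (Fin r) ℝ) (t : ℝ) :
    (gramIntegrand F Q t).PosSemidef := by
  rw [gramIntegrand_eq]; exact posSemidef_transpose_mul_mul hQ _

lemma transpose_gramIntegrand (hQ : Q.IsSymm) (F : Matrix (Fin r) (Fin r) ℝ) (t : ℝ) :
    (gramIntegrand F Q t)ᵀ = gramIntegrand F Q t := by
  simp [gramIntegrand_eq, Matrix.transpose_mul, hQ.eq, mul_assoc]

lemma isSymm_gram (hQ : Q.IsSymm) (F : Matrix (Fin r) (Fin r) ℝ) (t : ℝ) :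
    (gram F Q t).IsSymm := by
  let T : Matrix (Fin r) (Fin r) ℝ →L[ℝ] Matrix (Fin r) (Fin r) ℝ :=
    LinearMap.toContinuousLinearMap (Matrix.transposeLinearEquiv (Fin r) (Fin r) ℝ ℝ).toLinearMap
  have h := T.intervalIntegral_comp_comm
    ((continuous_gramIntegrand F Q).intervalIntegrable (μ := volume) 0 t)
  have hT : ∀ M, T M = Mᵀ := fun _ => rfl
  simp only [hT, transpose_gramIntegrand hQ] at h
  exact h.symm

lemma posSemidef_gram (hQ : Q.PosSemidef) (F : Matrix (Fin r) (Fin r) ℝ) {t : ℝ} (ht : 0 ≤ t) :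
    (gram F Q t).PosSemidef := by
  refine posSemidef_iff_quad.2 ⟨isSymm_gram (symm_of_posSemidef hQ) F t, fun x => ?_⟩
  rw [quad_gram]
  exact intervalIntegral.integral_nonneg ht fun s _ =>
    quad_nonneg (posSemidef_gramIntegrand hQ F s) x

lemma gram_sub_gram (F Q : Matrix (Fin r) (Fin r) ℝ) (s t : ℝ) (x : Fin r → ℝ) :
    x ⬝ᵥ gram F Q t *ᵥ x - x ⬝ᵥ gram F Q s *ᵥ x
      = ∫ u in s..t, x ⬝ᵥ gramIntegrand F Q u *ᵥ x := by
  rw [quad_gram, quad_gram, intervalIntegral.integral_interval_sub_left] <;>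
  exact (continuous_quad (continuous_gramIntegrand F Q) x).intervalIntegrable _ _

lemma quad_gram_mono (hQ : Q.PosSemidef) (F : Matrix (Fin r) (Fin r) ℝ) {s t : ℝ} (hst : s ≤ t)
    (x : Fin r → ℝ) : x ⬝ᵥ gram F Q s *ᵥ x ≤ x ⬝ᵥ gram F Q t *ᵥ x := by
  have := gram_sub_gram F Q s t x
  have h2 : 0 ≤ ∫ u in s..t, x ⬝ᵥ gramIntegrand F Q u *ᵥ x :=
    intervalIntegral.integral_nonneg hst fun u _ =>
      quad_nonneg (posSemidef_gramIntegrand hQ F u) x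
  linarith

/-! ### Observability -/

/-- The pair `(F, Q)` is observable: only the zero vector has `Q F ^ k x = 0` for all `k`. All
powers are used instead of the first `r`, so that no appeal to the Cayley–Hamilton theorem is needed. -/
def ObservablePair (F Q : Matrix (Fin r) (Fin r) ℝ) : Prop :=
  ∀ x : Fin r → ℝ, (∀ k : ℕ, Q *ᵥ (F ^ k *ᵥ x) = 0) → x = 0

/-- A subspace inside the kernel of `Q` that is invariant under `F` vanishes. -/
lemma ObservablePair.eq_zero_of_invariant (h : ObservablePair F Q) (p : (Fin r → ℝ) → Prop)
    (hF : ∀ x, p x → p (F *ᵥ x)) (hQ : ∀ x, p x → Q *ᵥ x = 0) {x : Fin r → ℝ} (hx : p x) :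
    x = 0 := by
  refine h x fun k => hQ _ ?_
  induction k with
  | zero => simpa using hx
  | succ k ih => rw [pow_succ', ← Matrix.mulVec_mulVec]; exact hF _ ih

/-- Observability survives output feedback: if the kernel of `Q'` lies in that of `Q`, then `F` and
`F'` need only agree on the kernel of `Q'`. -/
lemma ObservablePair.of_feedback {F' Q' : Matrix (Fin r) (Fin r) ℝ} (h : ObservablePair F Q)
    (hQ : ∀ x, Q' *ᵥ x = 0 → Q *ᵥ x = 0) (hF : ∀ x, Q' *ᵥ x = 0 → F' *ᵥ x = F *ᵥ x) :
    ObservablePair F' Q' := by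
  intro x hx
  refine h.eq_zero_of_invariant (fun y => ∀ k : ℕ, Q' *ᵥ (F' ^ k *ᵥ y) = 0) ?_ ?_ hx
  · intro y hy k
    have h0 := hy 0
    rw [pow_zero, Matrix.one_mulVec] at h0
    have h1 := hy (k + 1)
    rwa [pow_succ, ← Matrix.mulVec_mulVec, hF y h0] at h1
  · intro y hy
    have h0 := hy 0
    rw [pow_zero, Matrix.one_mulVec] at h0
    exact hQ y h0

lemma observablePair_of_posDef (hQ : Q.PosDef) (F : Matrix (Fin r) (Fin r) ℝ) :
    ObservablePair F Q := fun x hx => by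
  have h0 := hx 0
  rw [pow_zero, Matrix.one_mulVec] at h0
  exact mulVec_injective_of_posDef hQ h0

lemma hasDerivAt_mulVec {f : ℝ → Matrix (Fin r) (Fin r) ℝ} {f' : Matrix (Fin r) (Fin r) ℝ} {t : ℝ}
    (hf : HasDerivAt f f' t) (x : Fin r → ℝ) :
    HasDerivAt (fun s => f s *ᵥ x) (f' *ᵥ x) t := by
  let T : Matrix (Fin r) (Fin r) ℝ →L[ℝ] (Fin r → ℝ) :=
    LinearMap.toContinuousLinearMap ((Matrix.mulVecBilin ℝ ℝ).flip x)
  exact T.hasFDerivAt.comp_hasDerivAt t hf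

/-- If the output `Q e^{sF} x` vanishes on an interval, so do all its derivatives. -/
lemma ObservablePair.eq_zero_of_output (h : ObservablePair F Q) {t : ℝ} (ht : 0 < t)
    {x : Fin r → ℝ} (hx : ∀ s ∈ Ioo 0 t, Q *ᵥ (NormedSpace.exp (s • F) *ᵥ x) = 0) : x = 0 := by
  have key : ∀ k : ℕ, ∀ s ∈ Ioo 0 t, (Q * F ^ k * NormedSpace.exp (s • F)) *ᵥ x = 0 := by
    intro k
    induction k with
    | zero => intro s hs; simpa [Matrix.mulVec_mulVec] using hx s hs
    | succ k ih =>
      intro s hs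
      have h1 := hasDerivAt_mulVec ((hasDerivAt_exp F s).const_mul (Q * F ^ k)) x
      have h2 : (fun u : ℝ => (Q * F ^ k * NormedSpace.exp (u • F)) *ᵥ x) =ᶠ[𝓝 s] fun _ => 0 := by
        filter_upwards [isOpen_Ioo.mem_nhds hs] with u hu using ih u hu
      have h3 := h1.unique ((hasDerivAt_const s (0 : Fin r → ℝ)).congr_of_eventuallyEq h2)
      rw [pow_succ, ← h3]; simp only [mul_assoc]
  have h0 := h (NormedSpace.exp ((t / 2) • F) *ᵥ x) fun k => by
    have := key k (t / 2) ⟨by linarith, by linarith⟩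
    simpa [Matrix.mulVec_mulVec, mul_assoc] using this
  have hu := Matrix.isUnit_exp ((t / 2) • F)
  have := congrArg ((NormedSpace.exp ((t / 2) • F))⁻¹ *ᵥ ·) h0
  simpa [Matrix.mulVec_mulVec,
    Matrix.nonsing_inv_mul _ ((Matrix.isUnit_iff_isUnit_det _).1 hu)] using this

lemma posDef_gram (hQ : Q.PosSemidef) (h : ObservablePair F Q) {t : ℝ} (ht : 0 < t) :
    (gram F Q t).PosDef := by
  refine posDef_of_ker (posSemidef_gram hQ F ht.le) fun x hx => h.eq_zero_of_output ht ?_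
  intro s hs
  refine mulVec_eq_zero_of_quad hQ ?_
  by_contra hne
  have hq : ∀ u, 0 ≤ x ⬝ᵥ gramIntegrand F Q u *ᵥ x := fun u =>
    quad_nonneg (posSemidef_gramIntegrand hQ F u) x
  have hpos : 0 < ∫ u in (0 : ℝ)..t, x ⬝ᵥ gramIntegrand F Q u *ᵥ x := by
    refine intervalIntegral.integral_pos ht
      (continuous_quad (continuous_gramIntegrand F Q) x).continuousOn (fun u _ => hq u)
      ⟨s, Ioo_subset_Icc_self hs, lt_of_le_of_ne (hq s) fun h0 => hne ?_⟩
    rw [gramIntegrand_eq, dotProduct_transpose_mul_mul] at h0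
    exact h0.symm
  rw [← quad_gram, hx, dotProduct_zero] at hpos
  exact lt_irrefl _ hpos

/-! ### Exponential stability and the Lyapunov equation -/

/-- The flow `e^{tF}` decays exponentially. This is the form of stability used in the estimates;
it implies `IsHurwitz`. -/
def ExpStable (F : Matrix (Fin r) (Fin r) ℝ) : Prop :=
  ∃ C c : ℝ, 0 ≤ C ∧ 0 < c ∧ ∀ t : ℝ, 0 ≤ t → ‖NormedSpace.exp (t • F)‖ ≤ C * Real.exp (-c * t)

lemma ExpStable.transpose (h : ExpStable F) : ExpStable Fᵀ := by
  obtain ⟨C, c, hC, hc, h⟩ := h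
  refine ⟨C, c, hC, hc, fun t ht => ?_⟩
  rw [exp_smul_transpose, norm_transpose]
  exact h t ht

lemma ExpStable.tendsto_exp (h : ExpStable F) :
    Tendsto (fun t : ℝ => NormedSpace.exp (t • F)) atTop (𝓝 0) := by
  obtain ⟨C, c, hC, hc, h⟩ := h
  refine squeeze_zero_norm' (a := fun t => C * Real.exp (-c * t)) ?_ ?_
  · filter_upwards [eventually_ge_atTop 0] with t ht using h t ht
  · have : Tendsto (fun t : ℝ => Real.exp (-c * t)) atTop (𝓝 0) :=
      Real.tendsto_exp_atBot.comp (tendsto_id.const_mul_atTop_of_neg (by linarith))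
    simpa using this.const_mul C

/-- A positive definite Lyapunov function bounds the flow. -/
lemma exists_norm_exp_le_of_lyapunov (hX : X.PosDef) (hQ : Q.PosSemidef)
    (h : Fᵀ * X + X * F + Q = 0) :
    ∃ C : ℝ, 0 ≤ C ∧ ∀ t : ℝ, 0 ≤ t → ‖NormedSpace.exp (t • F)‖ ≤ C := by
  obtain ⟨a, ha, hlow⟩ := exists_pos_mul_le_quad hX
  refine ⟨√(‖X‖ / a), Real.sqrt_nonneg _, fun t ht => ?_⟩
  refine norm_le_of_mulVec (Real.sqrt_nonneg _) fun x => ?_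
  refine le_of_sq_le_sq ?_ (by positivity)
  rw [mul_pow, Real.sq_sqrt (by positivity), ← dotProduct_self_eq_norm_sq,
    ← dotProduct_self_eq_norm_sq, div_mul_eq_mul_div, le_div_iff₀ ha, mul_comm]
  calc _ ≤ _ := hlow _
    _ = x ⬝ᵥ gramIntegrand F X t *ᵥ x := by
      rw [gramIntegrand_eq, dotProduct_transpose_mul_mul]
    _ = x ⬝ᵥ X *ᵥ x - x ⬝ᵥ gram F Q t *ᵥ x := by
      rw [gramIntegrand_of_lyapunov h, Matrix.sub_mulVec, dotProduct_sub]
    _ ≤ x ⬝ᵥ X *ᵥ x := sub_le_self _ (quad_nonneg (posSemidef_gram hQ F ht) x)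
    _ ≤ _ := quad_le_norm X x

lemma exp_smul_add_smul_one (F : Matrix (Fin r) (Fin r) ℝ) (c t : ℝ) :
    NormedSpace.exp (t • (F + c • (1 : Matrix (Fin r) (Fin r) ℝ)))
      = Real.exp (c * t) • NormedSpace.exp (t • F) := by
  rw [smul_add, smul_smul, Matrix.exp_add_of_commute _ _
    ((Commute.one_right _).smul_right _), ← Algebra.algebraMap_eq_smul_one,
    ← NormedSpace.algebraMap_exp_comm, ← Real.exp_eq_exp_ℝ, Algebra.algebraMap_eq_smul_one,
    mul_smul_comm, mul_one, mul_comm c]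

/-- Lyapunov's criterion with an observable right-hand side. Averaging the Lyapunov function over
a unit of time makes its dissipation positive definite, which leaves room for a rate. -/
theorem expStable_of_lyapunov (hX : X.PosDef) (hQ : Q.PosSemidef) (hobs : ObservablePair F Q)
    (h : Fᵀ * X + X * F + Q = 0) : ExpStable F := by
  set Y := gram F X 1 with hY
  set W := gram F Q 1 with hW
  have hYpos : Y.PosDef := posDef_gram hX.posSemidef (observablePair_of_posDef hX F) one_pos
  have hWpos : W.PosDef := posDef_gram hQ hobs one_pos
  have hlyap : Fᵀ * Y + Y * F = -W := by
    rw [hY, gram_mul, gramIntegrand_of_lyapunov h]; abel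
  obtain ⟨a, ha, hlow⟩ := exists_pos_mul_le_quad hWpos
  have hb : 0 < ‖Y‖ + 1 := by positivity
  -- the rate `c` is small enough for `c Y ≤ W`; the `+ 1` covers `Y = 0` in dimension zero
  set c := a / (‖Y‖ + 1) with hc
  have hcpos : 0 < c := by positivity
  have hdiff : (W - c • Y).PosSemidef := by
    refine posSemidef_iff_quad.2 ⟨(symm_of_posSemidef hWpos.posSemidef).sub
      ((symm_of_posSemidef hYpos.posSemidef).smul c), fun x => ?_⟩
    have h1 := hlow x
    have h2 := quad_le_norm Y x
    have h3 : 0 ≤ x ⬝ᵥ x := by simpa using dotProduct_star_self_nonneg x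
    have h4 : c * (‖Y‖ + 1) = a := by rw [hc]; field_simp
    rw [Matrix.sub_mulVec, dotProduct_sub, Matrix.smul_mulVec, dotProduct_smul, smul_eq_mul]
    have h5 : c * (x ⬝ᵥ Y *ᵥ x) ≤ c * (‖Y‖ * (x ⬝ᵥ x)) := mul_le_mul_of_nonneg_left h2 hcpos.le
    have h6 : 0 ≤ c * (x ⬝ᵥ x) := by positivity
    rw [← h4] at h1
    nlinarith
  -- the shifted matrix still has `Y` as a Lyapunov function, so its flow is bounded
  have hshift : (F + (c / 2) • (1 : Matrix (Fin r) (Fin r) ℝ))ᵀ * Y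
      + Y * (F + (c / 2) • (1 : Matrix (Fin r) (Fin r) ℝ)) + (W - c • Y) = 0 := by
    have h1 : W = -(Fᵀ * Y + Y * F) := by rw [hlyap, neg_neg]
    rw [h1, Matrix.transpose_add, Matrix.transpose_smul, Matrix.transpose_one, add_mul, mul_add,
      smul_mul_assoc, mul_smul_comm, one_mul, mul_one]
    module
  obtain ⟨C, hC, hbound⟩ := exists_norm_exp_le_of_lyapunov hYpos hdiff hshift
  refine ⟨C, c / 2, hC, by positivity, fun t ht => ?_⟩
  have h1 := hbound t ht
  rw [exp_smul_add_smul_one, norm_smul, Real.norm_of_nonneg (Real.exp_pos _).le] at h1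
  rw [neg_mul, Real.exp_neg, ← div_eq_mul_inv, le_div_iff₀ (Real.exp_pos _), mul_comm]
  exact h1

/-- Exponential decay excludes eigenvalues in the closed right half plane. -/
theorem ExpStable.isHurwitz (h : ExpStable F) : IsHurwitz F := by
  intro z hz
  set Fc := F.map (algebraMap ℝ ℂ) with hFc
  let φ : Matrix (Fin r) (Fin r) ℝ →+* Matrix (Fin r) (Fin r) ℂ := (algebraMap ℝ ℂ).mapMatrix
  have hφ : Continuous φ := continuous_id.matrix_map (by exact Complex.continuous_ofReal)
  have hlim : Tendsto (fun t : ℝ => ‖φ (NormedSpace.exp (t • F))‖) atTop (𝓝 0) := by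
    have := ((hφ.tendsto 0).comp h.tendsto_exp).norm
    simpa using this
  have hexp : ∀ t : ℝ, φ (NormedSpace.exp (t • F)) = NormedSpace.exp ((t : ℂ) • Fc) := by
    intro t
    let : NormedAlgebra ℚ (Matrix (Fin r) (Fin r) ℝ) := NormedAlgebra.restrictScalars ℚ ℝ _
    rw [NormedSpace.map_exp φ hφ]
    congr 1
    ext i j
    simp [φ, hFc]
  have : Nontrivial (Matrix (Fin r) (Fin r) ℂ) := by
    by_contra hn
    rw [not_nontrivial_iff_subsingleton] at hn
    rw [spectrum.of_subsingleton] at hz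
    exact hz
  have hmem : ∀ t : ℝ, Real.exp (t * z.re) ≤ ‖φ (NormedSpace.exp (t • F))‖ := by
    intro t
    have h1 : (t : ℂ) * z ∈ spectrum ℂ ((t : ℂ) • Fc) := by
      rcases eq_or_ne t 0 with rfl | ht
      · simp [spectrum.zero_eq]
      · exact (spectrum.smul_mem_smul_iff
          (r := Units.mk0 (t : ℂ) (by exact_mod_cast ht)) (s := z) (a := Fc)).2 hz
    have h2 := spectrum.exp_mem_exp _ h1
    have h3 := spectrum.norm_le_norm_of_mem h2
    rw [← Complex.exp_eq_exp_ℂ, Complex.norm_exp] at h3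
    rw [hexp]
    simpa using h3
  by_contra! hre
  obtain ⟨t, ht0, ht⟩ := ((eventually_ge_atTop (0 : ℝ)).and
    (hlim.eventually_lt_const one_pos)).exists
  have h1 := hmem t
  have h2 : 1 ≤ Real.exp (t * z.re) := Real.one_le_exp (by positivity)
  linarith

lemma ExpStable.tendsto_mul_mul (hF : ExpStable F) (hG : ExpStable G)
    (X : Matrix (Fin r) (Fin r) ℝ) :
    Tendsto (fun t : ℝ => NormedSpace.exp (t • F) * X * NormedSpace.exp (t • G)) atTop (𝓝 0) := by
  simpa using (hF.tendsto_exp.mul_const X).mul hG.tendsto_exp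

/-- The homogeneous Sylvester equation with stable coefficients has only the trivial solution. -/
lemma eq_zero_of_sylvester (hF : ExpStable F) (hG : ExpStable G) (h : F * X + X * G = 0) :
    X = 0 := by
  -- `e^{sF} X e^{sG}` is constant, and tends to zero
  have hd : ∀ t : ℝ, HasDerivAt
      (fun s : ℝ => NormedSpace.exp (s • F) * X * NormedSpace.exp (s • G)) 0 t := fun t => by
    refine (((hasDerivAt_exp_smul_const F t).mul_const X).mul (hasDerivAt_exp G t)).congr_deriv ?_
    calc _ = NormedSpace.exp (t • F) * (F * X + X * G) * NormedSpace.exp (t • G) := by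
          noncomm_ring
      _ = 0 := by rw [h]; simp
  have hc : ∀ t : ℝ, NormedSpace.exp (t • F) * X * NormedSpace.exp (t • G) = X := fun t => by
    have := is_const_of_deriv_eq_zero (fun s => (hd s).differentiableAt) (fun s => (hd s).deriv) t 0
    simpa using this
  have := hF.tendsto_mul_mul hG X
  simp only [hc] at this
  exact tendsto_nhds_unique tendsto_const_nhds this

/-! ### The limiting Gramian -/

lemma ExpStable.tendsto_gramIntegrand (h : ExpStable F) (Q : Matrix (Fin r) (Fin r) ℝ) :
    Tendsto (gramIntegrand F Q) atTop (𝓝 0) :=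
  h.transpose.tendsto_mul_mul h Q

lemma ExpStable.integrableOn_gramIntegrand (h : ExpStable F) (Q : Matrix (Fin r) (Fin r) ℝ) :
    IntegrableOn (gramIntegrand F Q) (Ioi 0) := by
  obtain ⟨C, c, hC, hc, h⟩ := h
  have hI : IntegrableOn (fun t : ℝ => C * ‖Q‖ * C * Real.exp (-(2 * c) * t)) (Ioi 0) :=
    (exp_neg_integrableOn_Ioi 0 (by positivity)).const_mul _
  refine Integrable.mono' hI (continuous_gramIntegrand F Q).aestronglyMeasurable ?_
  refine (ae_restrict_iff' measurableSet_Ioi).2 (Eventually.of_forall fun t ht => ?_)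
  have h1 := h t (le_of_lt ht)
  rw [gramIntegrand_eq]
  calc _ ≤ ‖(NormedSpace.exp (t • F))ᵀ‖ * ‖Q‖ * ‖NormedSpace.exp (t • F)‖ :=
        (norm_mul_le _ _).trans (mul_le_mul_of_nonneg_right (norm_mul_le _ _) (norm_nonneg _))
    _ ≤ (C * Real.exp (-c * t)) * ‖Q‖ * (C * Real.exp (-c * t)) := by
        rw [norm_transpose]; gcongr
    _ = C * ‖Q‖ * C * (Real.exp (-c * t) * Real.exp (-c * t)) := by ring
    _ = _ := by rw [← Real.exp_add]; ring_nf

lemma ExpStable.tendsto_gram (h : ExpStable F) (Q : Matrix (Fin r) (Fin r) ℝ) :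
    Tendsto (gram F Q) atTop (𝓝 (gramInf F Q)) :=
  intervalIntegral_tendsto_integral_Ioi 0 (h.integrableOn_gramIntegrand Q) tendsto_id

lemma ExpStable.gramInf_mul (h : ExpStable F) (Q : Matrix (Fin r) (Fin r) ℝ) :
    Fᵀ * gramInf F Q + gramInf F Q * F + Q = 0 := by
  have h1 := ((h.tendsto_gram Q).const_mul Fᵀ).add ((h.tendsto_gram Q).mul_const F)
  simp only [gram_mul] at h1
  have h2 := tendsto_nhds_unique h1 ((h.tendsto_gramIntegrand Q).sub_const Q)
  rw [h2]; simp

lemma ExpStable.eq_gramInf (h : ExpStable F) (hX : Fᵀ * X + X * F + Q = 0) : X = gramInf F Q := by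
  have h1 := h.tendsto_gramIntegrand X
  rw [funext (gramIntegrand_of_lyapunov hX)] at h1
  exact sub_eq_zero.1 (tendsto_nhds_unique ((h.tendsto_gram Q).const_sub X) h1)

lemma ExpStable.quad_gram_le (h : ExpStable F) (hQ : Q.PosSemidef) (t : ℝ) (x : Fin r → ℝ) :
    x ⬝ᵥ gram F Q t *ᵥ x ≤ x ⬝ᵥ gramInf F Q *ᵥ x := by
  have h1 := ((quadCLM x).continuous.tendsto _).comp (h.tendsto_gram Q)
  refine ge_of_tendsto h1 ?_
  filter_upwards [eventually_ge_atTop t] with s hs using quad_gram_mono hQ F hs x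

lemma ExpStable.posSemidef_gramInf (h : ExpStable F) (hQ : Q.PosSemidef) :
    (gramInf F Q).PosSemidef := by
  refine posSemidef_iff_quad.2 ⟨?_, fun x => ?_⟩
  · have h1 : Tendsto (fun t => (gram F Q t)ᵀ) atTop (𝓝 (gramInf F Q)ᵀ) :=
      (continuous_id.matrix_transpose.tendsto _).comp (h.tendsto_gram Q)
    refine tendsto_nhds_unique h1 ((h.tendsto_gram Q).congr fun t => ?_)
    exact (isSymm_gram (symm_of_posSemidef hQ) F t).symm
  · simpa [gram_zero] using h.quad_gram_le hQ 0 x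

/-- A positive semidefinite Lyapunov solution is definite under observability: its kernel is an
invariant subspace inside the kernel of `Q`. -/
lemma posDef_of_lyapunov (hX : X.PosSemidef) (hQ : Q.PosSemidef) (hobs : ObservablePair F Q)
    (h : Fᵀ * X + X * F + Q = 0) : X.PosDef := by
  have hker : ∀ x, X *ᵥ x = 0 → Q *ᵥ x = 0 := fun x hx => by
    refine mulVec_eq_zero_of_quad hQ ?_
    have h1 : x ⬝ᵥ (Fᵀ * X + X * F + Q) *ᵥ x = 0 := by rw [h]; simp
    have h2 : x ⬝ᵥ (X * F) *ᵥ x = 0 := by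
      rw [← Matrix.mulVec_mulVec, Matrix.dotProduct_mulVec, ← Matrix.mulVec_transpose,
        symm_of_posSemidef hX, hx, zero_dotProduct]
    rw [Matrix.add_mulVec, Matrix.add_mulVec, dotProduct_add, dotProduct_add, h2,
      ← Matrix.mulVec_mulVec, hx] at h1
    simpa using h1
  refine posDef_of_ker hX fun x hx =>
    hobs.eq_zero_of_invariant (fun y => X *ᵥ y = 0) (fun y hy => ?_) hker hx
  have h1 : (Fᵀ * X + X * F + Q) *ᵥ y = 0 := by rw [h]; simp
  rw [Matrix.add_mulVec, Matrix.add_mulVec, hker y hy, ← Matrix.mulVec_mulVec, hy] at h1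
  simpa [Matrix.mulVec_mulVec] using h1

lemma ExpStable.posDef_gramInf (h : ExpStable F) (hQ : Q.PosSemidef) (hobs : ObservablePair F Q) :
    (gramInf F Q).PosDef :=
  posDef_of_lyapunov (h.posSemidef_gramInf hQ) hQ hobs (h.gramInf_mul Q)

/-! ### From Kalman rank conditions to observable pairs -/

lemma mulVec_eq_zero_of_rank_eq {m : Type*} [Fintype m] {K : Matrix m (Fin r) ℝ}
    (h : K.rank = r) {x : Fin r → ℝ} (hx : K *ᵥ x = 0) : x = 0 := by
  have h1 := K.mulVecLin.finrank_range_add_finrank_ker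
  have h2 : Module.finrank ℝ (LinearMap.range K.mulVecLin) = r := h
  rw [h2, Module.finrank_fin_fun] at h1
  have h3 : LinearMap.ker K.mulVecLin = ⊥ := Submodule.finrank_eq_zero.1 (by omega)
  exact LinearMap.ker_eq_bot'.1 h3 x hx

lemma ObservablePair.of_isObservable {H : Matrix (Fin r) (Fin r) ℝ} (hS : IsSymmSqrt S H)
    (h : IsObservable A H) : ObservablePair A S := by
  intro x hx
  refine mulVec_eq_zero_of_rank_eq h ?_
  ext ⟨k, j⟩
  have hk : H *ᵥ (A ^ (k : ℕ) *ᵥ x) = 0 := by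
    have h1 := dotProduct_transpose_mul_mul (A ^ (k : ℕ) *ᵥ x) 1 H
    rw [mul_one, Matrix.one_mulVec, hS.1.eq, hS.2, hx k, dotProduct_zero] at h1
    exact dotProduct_self_eq_zero.1 h1.symm
  rw [Matrix.mulVec_mulVec] at hk
  exact congrFun hk j

lemma ObservablePair.of_isControllable {H : Matrix (Fin r) (Fin r) ℝ} (hR : IsSymmSqrt R H)
    (h : IsControllable A H) : ObservablePair Aᵀ R := by
  refine ObservablePair.of_isObservable hR ?_
  rw [IsControllable, ← Matrix.rank_transpose] at h
  have hk : ∀ k : ℕ, H * Aᵀ ^ k = (A ^ k * H)ᵀ := fun k => by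
    rw [Matrix.transpose_mul, hR.1.eq, Matrix.transpose_pow]
  simp only [IsObservable, hk]
  exact h

/-! ### Closed loops -/

lemma transpose_sub_mul (hX : X.IsSymm) (hS : S.IsSymm) : (A - X * S)ᵀ = Aᵀ - S * X := by
  rw [Matrix.transpose_sub, Matrix.transpose_mul, hX.eq, hS.eq]

lemma posSemidef_mul_mul (hS : S.PosSemidef) (hX : X.IsSymm) : (X * S * X).PosSemidef := by
  simpa [hX.eq] using posSemidef_transpose_mul_mul hS X

/-- Controllability of `(A, R)` passes to every closed loop `A - X S`. -/
lemma ObservablePair.closedLoop (hC : ObservablePair Aᵀ R) (hR : R.PosSemidef) (hS : S.PosSemidef)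
    (hX : X.IsSymm) (hM : M.PosSemidef) : ObservablePair (A - X * S)ᵀ (R + X * S * X + M) := by
  have hXSX := posSemidef_mul_mul hS hX
  refine hC.of_feedback (fun x hx => ?_) (fun x hx => ?_)
  · exact (mulVec_eq_zero_of_add hR hXSX (mulVec_eq_zero_of_add (hR.add hXSX) hM hx).1).1
  · have h1 := (mulVec_eq_zero_of_add hR hXSX (mulVec_eq_zero_of_add (hR.add hXSX) hM hx).1).2
    have h2 : S *ᵥ (X *ᵥ x) = 0 := by
      refine mulVec_eq_zero_of_quad hS ?_
      have h3 := dotProduct_transpose_mul_mul x S X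
      rw [hX.eq, h1, dotProduct_zero] at h3
      exact h3.symm
    rw [transpose_sub_mul hX (symm_of_posSemidef hS), Matrix.sub_mulVec, ← Matrix.mulVec_mulVec,
      h2, sub_zero]

lemma ObservablePair.closedLoop' (hC : ObservablePair Aᵀ R) (hR : R.PosSemidef)
    (hS : S.PosSemidef) (hX : X.IsSymm) : ObservablePair (A - X * S)ᵀ (R + X * S * X) := by
  simpa using hC.closedLoop hR hS hX Matrix.PosSemidef.zero

lemma ExpStable.of_transpose (h : ExpStable Fᵀ) : ExpStable F := by
  simpa using h.transpose

/-- The Riccati equation read as a Lyapunov equation for the closed loop. -/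
lemma drift_eq_lyapunov (hX : X.IsSymm) (hS : S.IsSymm) :
    drift A R S X = (A - X * S) * X + X * (A - X * S)ᵀ + (R + X * S * X) := by
  rw [transpose_sub_mul hX hS, drift]; noncomm_ring

/-- Positive definite solutions are stabilizing. -/
lemma expStable_of_drift_eq_zero (hC : ObservablePair Aᵀ R) (hR : R.PosSemidef)
    (hS : S.PosSemidef) (hP : P.PosDef) (h : drift A R S P = 0) : ExpStable (A - P * S) := by
  have hPs := symm_of_posSemidef hP.posSemidef
  rw [drift_eq_lyapunov hPs (symm_of_posSemidef hS)] at h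
  refine ExpStable.of_transpose (expStable_of_lyapunov hP (hR.add (posSemidef_mul_mul hS hPs))
    (hC.closedLoop' hR hS hPs) ?_)
  rwa [Matrix.transpose_transpose]

lemma ObservablePair.neg (h : ObservablePair F Q) : ObservablePair (-F) Q := by
  intro x hx
  refine h x fun k => ?_
  have := hx k
  rcases neg_one_pow_eq_or (Matrix (Fin r) (Fin r) ℝ) k with h1 | h1 <;>
  simpa [neg_pow F, h1, Matrix.neg_mulVec, Matrix.mulVec_neg] using this

/-- Negative definite solutions are anti-stabilizing. -/
lemma expStable_neg_of_drift_eq_zero (hC : ObservablePair Aᵀ R) (hR : R.PosSemidef)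
    (hS : S.PosSemidef) (hN : (-N).PosDef) (h : drift A R S N = 0) :
    ExpStable (-(A - N * S)) := by
  have hNs : N.IsSymm := by simpa using (symm_of_posSemidef hN.posSemidef).neg
  rw [drift_eq_lyapunov hNs (symm_of_posSemidef hS)] at h
  refine ExpStable.of_transpose (expStable_of_lyapunov hN (hR.add (posSemidef_mul_mul hS hNs))
    ?_ ?_)
  · rw [Matrix.transpose_neg]
    exact (hC.closedLoop' hR hS hNs).neg
  · rw [Matrix.transpose_transpose, Matrix.transpose_neg, neg_mul_neg, neg_mul_neg]
    exact h

/-- The difference of two solutions solves a Sylvester equation in the two closed loops. -/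
lemma drift_sub_drift (hY : Y.IsSymm) (hS : S.IsSymm) :
    drift A R S X - drift A R S Y = (A - X * S) * (X - Y) + (X - Y) * (A - Y * S)ᵀ := by
  rw [transpose_sub_mul hY hS, drift, drift]; noncomm_ring

lemma eq_of_drift_eq_zero (hC : ObservablePair Aᵀ R) (hR : R.PosSemidef) (hS : S.PosSemidef)
    (hX : X.PosDef) (hY : Y.PosDef) (hX0 : drift A R S X = 0) (hY0 : drift A R S Y = 0) :
    X = Y := by
  have h := drift_sub_drift (A := A) (R := R) (X := X) (symm_of_posSemidef hY.posSemidef)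
    (symm_of_posSemidef hS)
  rw [hX0, hY0, sub_zero] at h
  exact sub_eq_zero.1 (eq_zero_of_sylvester (expStable_of_drift_eq_zero hC hR hS hX hX0)
    (expStable_of_drift_eq_zero hC hR hS hY hY0).transpose h.symm)

lemma eq_of_drift_eq_zero_of_neg (hC : ObservablePair Aᵀ R) (hR : R.PosSemidef)
    (hS : S.PosSemidef) (hX : (-X).PosDef) (hY : (-Y).PosDef) (hX0 : drift A R S X = 0)
    (hY0 : drift A R S Y = 0) : X = Y := by
  have hYs : Y.IsSymm := by simpa using (symm_of_posSemidef hY.posSemidef).neg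
  have h := drift_sub_drift (A := A) (R := R) (X := X) hYs (symm_of_posSemidef hS)
  rw [hX0, hY0, sub_zero] at h
  refine sub_eq_zero.1 (eq_zero_of_sylvester (expStable_neg_of_drift_eq_zero hC hR hS hX hX0)
    (expStable_neg_of_drift_eq_zero hC hR hS hY hY0).transpose ?_)
  rw [Matrix.transpose_neg, neg_mul, mul_neg, ← neg_add, ← h, neg_zero]

/-! ### Existence of the stabilizing solution -/

/-- Observability yields a stabilizing gain, from the Gramian of the time-reversed system. -/
lemma exists_expStable_sub (hS : S.PosSemidef) (hO : ObservablePair A S) :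
    ∃ X : Matrix (Fin r) (Fin r) ℝ, X.PosDef ∧ ExpStable (A - X * S) := by
  have hG : (gram (-A) S 1).PosDef := posDef_gram hS hO.neg one_pos
  set G := gram (-A) S 1
  have hE := posSemidef_gramIntegrand hS (-A) 1
  set E := gramIntegrand (-A) S 1
  have hGE : (-A)ᵀ * G + G * -A = E - S := gram_mul (-A) S 1
  have hGi := (Matrix.isUnit_iff_isUnit_det _).1 hG.isUnit
  have hSs := symm_of_posSemidef hS
  refine ⟨G⁻¹, hG.inv, expStable_of_lyapunov hG (hS.add hE)
    (hO.of_feedback (fun x hx => (mulVec_eq_zero_of_add hS hE hx).1) fun x hx => ?_) ?_⟩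
  · rw [Matrix.sub_mulVec, ← Matrix.mulVec_mulVec, (mulVec_eq_zero_of_add hS hE hx).1]
    simp
  · rw [transpose_sub_mul (symm_of_posSemidef hG.inv.posSemidef) hSs, sub_mul, mul_sub,
      ← mul_assoc G, Matrix.mul_nonsing_inv _ hGi, mul_assoc S, Matrix.nonsing_inv_mul _ hGi,
      one_mul, mul_one]
    rw [Matrix.transpose_neg, neg_mul, mul_neg] at hGE
    calc _ = -(-(Aᵀ * G) + -(G * A)) - S - S + (S + E) := by abel
      _ = 0 := by rw [hGE]; abel

/-- One step of Newton's method for the Riccati equation (Kleinman's iteration): the Riccati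
equation linearized at `X`, which is a Lyapunov equation for the closed loop `A - X S`, solved by a
Gramian. -/
noncomputable def newtonStep (A R S X : Matrix (Fin r) (Fin r) ℝ) : Matrix (Fin r) (Fin r) ℝ :=
  gramInf (A - X * S)ᵀ (R + X * S * X)

lemma newtonStep_lyapunov (R : Matrix (Fin r) (Fin r) ℝ) (hstab : ExpStable (A - X * S)) :
    (A - X * S) * newtonStep A R S X + newtonStep A R S X * (A - X * S)ᵀ + (R + X * S * X) = 0 := by
  simpa [newtonStep] using hstab.transpose.gramInf_mul (R + X * S * X)

lemma posDef_newtonStep (hC : ObservablePair Aᵀ R) (hR : R.PosSemidef) (hS : S.PosSemidef)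
    (hX : X.PosDef) (hstab : ExpStable (A - X * S)) : (newtonStep A R S X).PosDef := by
  have hXs := symm_of_posSemidef hX.posSemidef
  exact hstab.transpose.posDef_gramInf (hR.add (posSemidef_mul_mul hS hXs))
    (hC.closedLoop' hR hS hXs)

/-- The new closed loop is stable: the Lyapunov equation of the step, rewritten for the new closed
loop, gains a square. -/
lemma expStable_newtonStep (hC : ObservablePair Aᵀ R) (hR : R.PosSemidef) (hS : S.PosSemidef)
    (hX : X.PosDef) (hstab : ExpStable (A - X * S)) : ExpStable (A - newtonStep A R S X * S) := by
  have hY := posDef_newtonStep hC hR hS hX hstab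
  have hlyap := newtonStep_lyapunov R hstab
  set Y := newtonStep A R S X
  have hXs := symm_of_posSemidef hX.posSemidef
  have hYs := symm_of_posSemidef hY.posSemidef
  have hSs := symm_of_posSemidef hS
  have hd := posSemidef_mul_mul hS (hYs.sub hXs)
  refine ExpStable.of_transpose (expStable_of_lyapunov hY
    ((hR.add (posSemidef_mul_mul hS hYs)).add hd) (hC.closedLoop hR hS hYs hd) ?_)
  rw [transpose_sub_mul hXs hSs] at hlyap
  rw [Matrix.transpose_transpose, transpose_sub_mul hYs hSs, ← hlyap]
  noncomm_ring

/-- From the first step on, Newton's method decreases. -/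
lemma posSemidef_newtonStep_sub (hC : ObservablePair Aᵀ R) (hR : R.PosSemidef) (hS : S.PosSemidef)
    (hX : X.PosDef) (hstab : ExpStable (A - X * S)) :
    (newtonStep A R S X - newtonStep A R S (newtonStep A R S X)).PosSemidef := by
  have hY := posDef_newtonStep hC hR hS hX hstab
  have hstab' := expStable_newtonStep hC hR hS hX hstab
  have h1 := newtonStep_lyapunov R hstab
  have h2 := newtonStep_lyapunov R hstab'
  set Y := newtonStep A R S X
  set Z := newtonStep A R S Y
  have hXs := symm_of_posSemidef hX.posSemidef
  have hYs := symm_of_posSemidef hY.posSemidef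
  have hSs := symm_of_posSemidef hS
  have hd := posSemidef_mul_mul hS (hYs.sub hXs)
  have h : (A - Y * S)ᵀᵀ * (Y - Z) + (Y - Z) * (A - Y * S)ᵀ + (Y - X) * S * (Y - X) = 0 := by
    rw [transpose_sub_mul hXs hSs] at h1
    rw [transpose_sub_mul hYs hSs] at h2
    rw [Matrix.transpose_transpose, transpose_sub_mul hYs hSs, ← sub_zero (0 : Matrix _ _ ℝ)]
    nth_rw 1 [← h1]
    rw [← h2]
    noncomm_ring
  rw [hstab'.transpose.eq_gramInf h]
  exact hstab'.transpose.posSemidef_gramInf hd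

/-- A decreasing sequence of positive semidefinite matrices converges: its quadratic forms do, and
polarization recovers the entries. -/
lemma exists_tendsto_of_antitone {Z : ℕ → Matrix (Fin r) (Fin r) ℝ} (hZ : ∀ n, (Z n).PosSemidef)
    (hdec : ∀ n, (Z n - Z (n + 1)).PosSemidef) :
    ∃ P : Matrix (Fin r) (Fin r) ℝ, P.PosSemidef ∧ Tendsto Z atTop (𝓝 P) := by
  have hquad : ∀ x : Fin r → ℝ, ∃ l : ℝ, Tendsto (fun n => x ⬝ᵥ Z n *ᵥ x) atTop (𝓝 l) := by
    intro x
    refine ⟨_, tendsto_atTop_ciInf (antitone_nat_of_succ_le fun n => ?_)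
      ⟨0, by rintro _ ⟨n, rfl⟩; exact quad_nonneg (hZ n) x⟩⟩
    have := quad_nonneg (hdec n) x
    rw [Matrix.sub_mulVec, dotProduct_sub] at this
    linarith
  choose l hl using hquad
  have hpol : ∀ (n : ℕ) (i j : Fin r), Z n i j
      = ((Pi.single i 1 + Pi.single j 1) ⬝ᵥ Z n *ᵥ (Pi.single i 1 + Pi.single j 1)
        - Pi.single i 1 ⬝ᵥ Z n *ᵥ Pi.single i 1 - Pi.single j 1 ⬝ᵥ Z n *ᵥ Pi.single j 1) / 2 := by
    intro n i j
    have hs : Z n j i = Z n i j := (symm_of_posSemidef (hZ n)).apply i j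
    simp only [Matrix.mulVec_add, add_dotProduct, dotProduct_add, Matrix.mulVec_single_one,
      single_one_dotProduct, Matrix.col_apply, hs]
    ring
  have hlim : Tendsto Z atTop (𝓝 (Matrix.of fun i j =>
      (l (Pi.single i 1 + Pi.single j 1) - l (Pi.single i 1) - l (Pi.single j 1)) / 2)) := by
    refine tendsto_pi_nhds.2 fun i => tendsto_pi_nhds.2 fun j => ?_
    simp only [hpol, Matrix.of_apply]
    exact (((hl _).sub (hl _)).sub (hl _)).div_const 2
  refine ⟨_, posSemidef_iff_quad.2 ⟨?_, fun x => ?_⟩, hlim⟩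
  · refine tendsto_nhds_unique ((continuous_id.matrix_transpose.tendsto _).comp hlim)
      (hlim.congr fun n => ?_)
    exact (symm_of_posSemidef (hZ n)).eq.symm
  · exact ge_of_tendsto' (((quadCLM x).continuous.tendsto _).comp hlim)
      fun n => quad_nonneg (hZ n) x

/-- The limit of Newton's method solves the Riccati equation; controllability makes it definite. -/
theorem exists_stabilizing (hR : R.PosSemidef) (hS : S.PosSemidef) (hO : ObservablePair A S)
    (hC : ObservablePair Aᵀ R) : ∃ P : Matrix (Fin r) (Fin r) ℝ, P.PosDef ∧ drift A R S P = 0 := by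
  obtain ⟨X, hX, hstab⟩ := exists_expStable_sub hS hO
  let Z : ℕ → Matrix (Fin r) (Fin r) ℝ := fun n => (newtonStep A R S)^[n] X
  have hZ1 : ∀ n, Z (n + 1) = newtonStep A R S (Z n) := fun n =>
    Function.iterate_succ_apply' _ _ _
  have hZ : ∀ n, (Z n).PosDef ∧ ExpStable (A - Z n * S) := by
    intro n
    induction n with
    | zero => exact ⟨hX, hstab⟩
    | succ n ih =>
      rw [hZ1]
      exact ⟨posDef_newtonStep hC hR hS ih.1 ih.2, expStable_newtonStep hC hR hS ih.1 ih.2⟩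
  obtain ⟨P, hP, hlim⟩ := exists_tendsto_of_antitone (Z := fun n => Z (n + 1))
    (fun n => (hZ (n + 1)).1.posSemidef) fun n => by
      rw [hZ1 (n + 1), hZ1 n]
      exact posSemidef_newtonStep_sub hC hR hS (hZ n).1 (hZ n).2
  have hPs := symm_of_posSemidef hP
  have hSs := symm_of_posSemidef hS
  have hlim' : Tendsto Z atTop (𝓝 P) := (tendsto_add_atTop_iff_nat 1).1 hlim
  have hlyap : (A - P * S) * P + P * (A - P * S)ᵀ + (R + P * S * P) = 0 := by
    have hF : Tendsto (fun n => A - Z n * S) atTop (𝓝 (A - P * S)) :=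
      (hlim'.mul_const S).const_sub A
    have hFt : Tendsto (fun n => (A - Z n * S)ᵀ) atTop (𝓝 (A - P * S)ᵀ) :=
      (continuous_id.matrix_transpose.tendsto _).comp hF
    have h := ((hF.mul hlim).add (hlim.mul hFt)).add
      (((hlim'.mul_const S).mul hlim').const_add R)
    refine tendsto_nhds_unique h (tendsto_const_nhds.congr fun n => ?_)
    rw [hZ1, newtonStep_lyapunov R (hZ n).2]
  refine ⟨P, ?_, by rw [drift_eq_lyapunov hPs hSs, hlyap]⟩
  exact posDef_of_lyapunov hP (hR.add (posSemidef_mul_mul hS hPs)) (hC.closedLoop' hR hS hPs)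
    (by rwa [Matrix.transpose_transpose])

/-! ### The negative definite solution -/

lemma inv_mul_self_of_posDef (h : M.PosDef) : M⁻¹ * M = 1 :=
  Matrix.nonsing_inv_mul _ ((Matrix.isUnit_iff_isUnit_det _).1 h.isUnit)

lemma self_mul_inv_of_posDef (h : M.PosDef) : M * M⁻¹ = 1 :=
  Matrix.mul_nonsing_inv _ ((Matrix.isUnit_iff_isUnit_det _).1 h.isUnit)

lemma posDef_gramInf_closedLoop (hS : S.PosSemidef) (hO : ObservablePair A S)
    (hstab : ExpStable (A - P * S)) : (gramInf (A - P * S) S).PosDef :=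
  hstab.posDef_gramInf hS (hO.of_feedback (fun _ hx => hx) fun x hx => by
    rw [Matrix.sub_mulVec, ← Matrix.mulVec_mulVec, hx]; simp)

lemma drift_negPoint (hS : S.PosSemidef) (hO : ObservablePair A S) (hP : P.IsSymm)
    (hP0 : drift A R S P = 0) (hstab : ExpStable (A - P * S)) :
    drift A R S (negPoint A S P) = 0 := by
  have hG := posDef_gramInf_closedLoop hS hO hstab
  have hlyap := hstab.gramInf_mul S
  have h := drift_sub_drift (A := A) (R := R) (X := negPoint A S P) hP (symm_of_posSemidef hS)
  rw [hP0, sub_zero] at h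
  rw [h, negPoint]
  set B := A - P * S with hB
  set G := gramInf B S
  have h1 := inv_mul_self_of_posDef hG
  have h2 := self_mul_inv_of_posDef hG
  calc _ = -(B * G⁻¹ + G⁻¹ * Bᵀ + G⁻¹ * S * G⁻¹) := by rw [hB]; noncomm_ring
    _ = -(G⁻¹ * (Bᵀ * G + G * B + S) * G⁻¹) := by
        congr 1
        simp only [mul_add, add_mul]
        rw [← mul_assoc, mul_assoc _ G G⁻¹, h2, ← mul_assoc G⁻¹ G B, h1, one_mul, mul_one]
        abel
    _ = 0 := by rw [hlyap]; simp

lemma isSymm_negPoint (hS : S.PosSemidef) (hO : ObservablePair A S) (hP : P.IsSymm)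
    (hstab : ExpStable (A - P * S)) : (negPoint A S P).IsSymm :=
  hP.sub (symm_of_posSemidef (posDef_gramInf_closedLoop hS hO hstab).inv.posSemidef)

/-- The time-reversed closed loop at `P⁻` is stable, with `S_∞` as Lyapunov function. -/
lemma expStable_neg_negPoint (hS : S.PosSemidef) (hO : ObservablePair A S)
    (hstab : ExpStable (A - P * S)) : ExpStable (-(A - negPoint A S P * S)) := by
  have hG := posDef_gramInf_closedLoop hS hO hstab
  have hlyap := hstab.gramInf_mul S
  have hF : -(A - negPoint A S P * S) = -((A - P * S) + (gramInf (A - P * S) S)⁻¹ * S) := by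
    rw [negPoint]; noncomm_ring
  refine expStable_of_lyapunov hG hS (hO.neg.of_feedback (fun _ hx => hx) fun x hx => ?_) ?_
  · rw [Matrix.neg_mulVec, Matrix.sub_mulVec, ← Matrix.mulVec_mulVec, hx, Matrix.neg_mulVec]
    simp
  · rw [hF]
    set B := A - P * S
    set G := gramInf B S
    rw [Matrix.transpose_neg, Matrix.transpose_add, Matrix.transpose_mul,
      symm_of_posSemidef hG.inv.posSemidef, symm_of_posSemidef hS]
    calc _ = -(Bᵀ * G + G * B + S) + S + S - S * (G⁻¹ * G) - (G * G⁻¹) * S := by noncomm_ring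
      _ = 0 := by
        rw [hlyap, inv_mul_self_of_posDef hG, self_mul_inv_of_posDef hG]; simp

lemma posDef_neg_negPoint (hR : R.PosSemidef) (hS : S.PosSemidef) (hO : ObservablePair A S)
    (hC : ObservablePair Aᵀ R) (hP : P.IsSymm) (hP0 : drift A R S P = 0)
    (hstab : ExpStable (A - P * S)) : (-negPoint A S P).PosDef := by
  have hNs := isSymm_negPoint hS hO hP hstab
  have hF := expStable_neg_negPoint hS hO hstab
  have h0 := drift_negPoint hS hO hP hP0 hstab
  rw [drift_eq_lyapunov hNs (symm_of_posSemidef hS)] at h0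
  set N := negPoint A S P
  have hlyap : (-(A - N * S))ᵀᵀ * -N + -N * (-(A - N * S))ᵀ + (R + N * S * N) = 0 := by
    rw [Matrix.transpose_transpose, Matrix.transpose_neg, neg_mul_neg, neg_mul_neg]
    exact h0
  have hQ := hR.add (posSemidef_mul_mul hS hNs)
  refine posDef_of_lyapunov ?_ hQ ?_ hlyap
  · rw [hF.transpose.eq_gramInf hlyap]
    exact hF.transpose.posSemidef_gramInf hQ
  · rw [Matrix.transpose_neg]
    exact (hC.closedLoop' hR hS hNs).neg

/-! ### Factorization and bounds of the Floquet matrix -/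

/-- Inversion reverses the Loewner order. -/
lemma quad_inv_le (hM : M.PosDef) (hN : N.PosDef) (h : ∀ x, x ⬝ᵥ M *ᵥ x ≤ x ⬝ᵥ N *ᵥ x)
    (x : Fin r → ℝ) : x ⬝ᵥ N⁻¹ *ᵥ x ≤ x ⬝ᵥ M⁻¹ *ᵥ x := by
  set y := N⁻¹ *ᵥ x with hy
  set z := M⁻¹ *ᵥ x with hz
  have hNy : N *ᵥ y = x := by
    rw [hy, Matrix.mulVec_mulVec, self_mul_inv_of_posDef hN, Matrix.one_mulVec]
  have hMz : M *ᵥ z = x := by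
    rw [hz, Matrix.mulVec_mulVec, self_mul_inv_of_posDef hM, Matrix.one_mulVec]
  -- expand `0 ≤ (z - y)ᵀ M (z - y)`
  have h1 := quad_nonneg hM.posSemidef (z - y)
  have h2 := h y
  have h3 : z ⬝ᵥ M *ᵥ y = x ⬝ᵥ y := by
    rw [Matrix.dotProduct_mulVec, ← Matrix.mulVec_transpose,
      symm_of_posSemidef hM.posSemidef, hMz]
  rw [Matrix.mulVec_sub, dotProduct_sub, sub_dotProduct, sub_dotProduct, hMz, h3,
    dotProduct_comm z x, dotProduct_comm y x] at h1
  rw [hNy, dotProduct_comm y x] at h2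
  linarith

/-- The symmetric factor `W_t = (S_t⁻¹ - S_∞⁻¹) + (Q - P⁻)` of the Floquet matrix
`C_t(Q) = W_t S_t`. -/
noncomputable def floquetFactor (A S P : Matrix (Fin r) (Fin r) ℝ) (t : ℝ)
    (Q : Matrix (Fin r) (Fin r) ℝ) : Matrix (Fin r) (Fin r) ℝ :=
  ((gram (A - P * S) S t)⁻¹ - (gramInf (A - P * S) S)⁻¹) + (Q - negPoint A S P)

lemma posDef_gram_closedLoop (hS : S.PosSemidef) (hO : ObservablePair A S)
    (P : Matrix (Fin r) (Fin r) ℝ) {t : ℝ} (ht : 0 < t) : (gram (A - P * S) S t).PosDef :=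
  posDef_gram hS (hO.of_feedback (fun _ hx => hx) fun x hx => by
    rw [Matrix.sub_mulVec, ← Matrix.mulVec_mulVec, hx]; simp) ht

lemma floquetFactor_eq (A S P Q : Matrix (Fin r) (Fin r) ℝ) (t : ℝ) :
    floquetFactor A S P t Q = (gram (A - P * S) S t)⁻¹ + (Q - P) := by
  rw [floquetFactor, negPoint]; abel

lemma floquetC_eq (hS : S.PosSemidef) (hO : ObservablePair A S) (P Q : Matrix (Fin r) (Fin r) ℝ)
    {t : ℝ} (ht : 0 < t) :
    floquetC A S P t Q = floquetFactor A S P t Q * gram (A - P * S) S t := by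
  rw [floquetFactor_eq, floquetC, add_mul,
    inv_mul_self_of_posDef (posDef_gram_closedLoop hS hO P ht)]

/-- The factor dominates `-P⁻`, uniformly in time and in `Q`. -/
lemma quad_le_floquetFactor (hS : S.PosSemidef) (hO : ObservablePair A S)
    (hstab : ExpStable (A - P * S)) (hQ : Q.PosSemidef) {t : ℝ} (ht : 0 < t) (x : Fin r → ℝ) :
    x ⬝ᵥ (-negPoint A S P) *ᵥ x ≤ x ⬝ᵥ floquetFactor A S P t Q *ᵥ x := by
  have h1 := quad_inv_le (posDef_gram_closedLoop hS hO P ht)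
    (posDef_gramInf_closedLoop hS hO hstab) (hstab.quad_gram_le hS t) x
  have h2 := quad_nonneg hQ x
  simp only [floquetFactor, Matrix.add_mulVec, Matrix.sub_mulVec, Matrix.neg_mulVec,
    dotProduct_add, dotProduct_sub, dotProduct_neg]
  linarith

lemma isUnit_floquetFactor (hS : S.PosSemidef) (hO : ObservablePair A S)
    (hstab : ExpStable (A - P * S)) (hN : (-negPoint A S P).PosDef)
    (hQ : Q.PosSemidef) {t : ℝ} (ht : 0 < t) : IsUnit (floquetFactor A S P t Q) := by
  refine Matrix.mulVec_injective_iff_isUnit.1 ?_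
  rw [← Matrix.coe_mulVecLin, injective_iff_map_eq_zero]
  intro x hx
  by_contra hne
  have h1 := quad_le_floquetFactor hS hO hstab hQ ht x
  have h2 := hN.dotProduct_mulVec_pos hne
  rw [Matrix.mulVecLin_apply] at hx
  rw [hx, dotProduct_zero] at h1
  rw [star_trivial] at h2
  linarith

lemma floquetC_zero (A S P Q : Matrix (Fin r) (Fin r) ℝ) : floquetC A S P 0 Q = 1 := by
  simp [floquetC, gram_zero]

lemma isUnit_floquetC (hS : S.PosSemidef) (hO : ObservablePair A S)
    (hstab : ExpStable (A - P * S)) (hN : (-negPoint A S P).PosDef)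
    (hQ : Q.PosSemidef) {t : ℝ} (ht : 0 ≤ t) : IsUnit (floquetC A S P t Q) := by
  rcases ht.eq_or_lt with rfl | ht
  · rw [floquetC_zero]; exact isUnit_one
  · rw [floquetC_eq hS hO P Q ht]
    exact (isUnit_floquetFactor hS hO hstab hN hQ ht).mul (posDef_gram_closedLoop hS hO P ht).isUnit

lemma norm_floquetC_inv_le_chiDelta (hr : 1 ≤ r) (hS : S.PosSemidef) (hO : ObservablePair A S)
    (hstab : ExpStable (A - P * S)) (hN : (-negPoint A S P).PosDef)
    (hQ : Q.PosSemidef) {δ t : ℝ} (hδ : 0 < δ) (ht : δ ≤ t) :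
    ‖(floquetC A S P t Q)⁻¹‖ ≤ chiDelta A S P δ := by
  have ht0 := hδ.trans_le ht
  have hGδ := posDef_gram_closedLoop hS hO P hδ
  have hpos := lambdaMin_pos hr hGδ
  rw [floquetC_eq hS hO P Q ht0, Matrix.mul_inv_rev, chiDelta, mul_inv]
  refine (norm_mul_le _ _).trans (mul_le_mul ?_ ?_ (norm_nonneg _) (inv_nonneg.2 hpos.le))
  · refine norm_inv_le hpos (fun x => ?_) (posDef_gram_closedLoop hS hO P ht0).isUnit
    exact (lambdaMin_mul_le (symm_of_posSemidef hGδ.posSemidef) x).trans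
      (quad_gram_mono hS _ ht x)
  · refine norm_inv_le (lambdaMin_pos hr hN) (fun x => ?_)
      (isUnit_floquetFactor hS hO hstab hN hQ ht0)
    exact (lambdaMin_mul_le (symm_of_posSemidef hN.posSemidef) x).trans
      (quad_le_floquetFactor hS hO hstab hQ ht0 x)

lemma norm_inv_neg (h : (-M).PosDef) : ‖(-M)⁻¹‖ = ‖M⁻¹‖ := by
  have hM : M⁻¹ = -(-M)⁻¹ := Matrix.inv_eq_left_inv (by
    rw [neg_mul_comm, inv_mul_self_of_posDef h])
  rw [hM, norm_neg]

lemma norm_inv_pos (hr : 1 ≤ r) (hM : M.PosDef) : 0 < ‖M⁻¹‖ := by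
  have : Nonempty (Fin r) := ⟨⟨0, hr⟩⟩
  have := hM.inv.isUnit.ne_zero
  exact norm_pos_iff.2 this

lemma one_le_norm_inv_mul_norm (hr : 1 ≤ r) (hP : P.PosSemidef) (hN : N.PosDef) :
    1 ≤ ‖N⁻¹‖ * ‖P + N‖ := by
  have h1 := inv_norm_inv_mul_le_quad hN (Pi.single ⟨0, hr⟩ 1)
  have h2 := quad_le_norm (P + N) (Pi.single ⟨0, hr⟩ 1)
  have h3 := quad_nonneg hP (Pi.single ⟨0, hr⟩ 1)
  rw [Matrix.add_mulVec, dotProduct_add] at h2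
  rw [← inv_le_iff_one_le_mul₀' (norm_inv_pos hr hN)]
  have h4 : (Pi.single ⟨0, hr⟩ 1 : Fin r → ℝ) ⬝ᵥ Pi.single ⟨0, hr⟩ 1 = 1 := by simp
  rw [h4, mul_one] at h1 h2
  linarith

lemma norm_floquetC_inv_le_chi (hr : 1 ≤ r) (hS : S.PosSemidef) (hO : ObservablePair A S)
    (hP : P.PosSemidef) (hstab : ExpStable (A - P * S)) (hN : (-negPoint A S P).PosDef)
    (hQ : Q.PosSemidef) {t : ℝ} (ht : 0 ≤ t) :
    ‖(floquetC A S P t Q)⁻¹‖ ≤ chi A S P Q := by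
  have : Nonempty (Fin r) := ⟨⟨0, hr⟩⟩
  have hone : 1 ≤ ‖(negPoint A S P)⁻¹‖ * ‖P - negPoint A S P‖ := by
    have := one_le_norm_inv_mul_norm hr hP hN
    rwa [norm_inv_neg hN, ← sub_eq_add_neg] at this
  rw [chi, mul_add]
  rcases ht.eq_or_lt with rfl | ht
  · rw [floquetC_zero, inv_one, norm_one]
    have : 0 ≤ ‖(negPoint A S P)⁻¹‖ * ‖Q - P‖ := by positivity
    linarith
  · have hW := isUnit_floquetFactor hS hO hstab hN hQ ht
    -- eliminating `S_t⁻¹` leaves only the inverse of the symmetric factor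
    have hinv : (floquetC A S P t Q)⁻¹ = 1 + -((Q - P) * (floquetFactor A S P t Q)⁻¹) := by
      have hG : (gram (A - P * S) S t)⁻¹ = floquetFactor A S P t Q - (Q - P) := by
        rw [floquetFactor_eq]; abel
      rw [floquetC_eq hS hO P Q ht, Matrix.mul_inv_rev, hG, sub_mul,
        Matrix.mul_nonsing_inv _ ((Matrix.isUnit_iff_isUnit_det _).1 hW), sub_eq_add_neg]
    have hWn : ‖(floquetFactor A S P t Q)⁻¹‖ ≤ ‖(negPoint A S P)⁻¹‖ := by
      rw [← norm_inv_neg hN, ← inv_inv ‖(-negPoint A S P)⁻¹‖]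
      refine norm_inv_le (inv_pos.2 (norm_inv_pos hr hN)) (fun x => ?_) hW
      exact (inv_norm_inv_mul_le_quad hN x).trans (quad_le_floquetFactor hS hO hstab hQ ht x)
    rw [hinv]
    refine (norm_add_le _ _).trans (add_le_add (by rwa [norm_one]) ?_)
    rw [norm_neg, mul_comm ‖(negPoint A S P)⁻¹‖]
    exact (norm_mul_le _ _).trans (mul_le_mul_of_nonneg_left hWn (norm_nonneg _))

/-! ### The Riccati flow and its transition matrices -/

lemma hasDerivAt_matrix_inv {f : ℝ → Matrix (Fin r) (Fin r) ℝ} {f' : Matrix (Fin r) (Fin r) ℝ}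
    {t : ℝ} (hf : HasDerivAt f f' t) (hu : IsUnit (f t)) :
    HasDerivAt (fun s => (f s)⁻¹) (-((f t)⁻¹ * f' * (f t)⁻¹)) t := by
  obtain ⟨u, hu⟩ := hu
  have h := hasFDerivAt_ringInverse (𝕜 := ℝ) u
  rw [hu] at h
  have h2 := h.comp_hasDerivAt t hf
  have h3 : (↑u⁻¹ : Matrix (Fin r) (Fin r) ℝ) = (f t)⁻¹ := by
    rw [← hu, Matrix.coe_units_inv]
  simp only [Function.comp_def, ← Matrix.nonsing_inv_eq_ringInverse] at h2
  refine h2.congr_deriv ?_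
  simp [h3]

/-- The closed form `e^{tB} C_t(Q)⁻¹` of the transition matrix from time `0`. -/
noncomputable def floquetFlow (A S P Q : Matrix (Fin r) (Fin r) ℝ) (t : ℝ) :
    Matrix (Fin r) (Fin r) ℝ :=
  NormedSpace.exp (t • (A - P * S)) * (floquetC A S P t Q)⁻¹

/-- The closed form `P + e^{tB} C_t(Q)⁻¹ (Q - P) e^{tB'}` of the Riccati flow. -/
noncomputable def riccatiFlow (A S P Q : Matrix (Fin r) (Fin r) ℝ) (t : ℝ) :
    Matrix (Fin r) (Fin r) ℝ :=
  P + floquetFlow A S P Q t * (Q - P) * NormedSpace.exp (t • (A - P * S)ᵀ)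

lemma hasDerivAt_floquetC (A S P Q : Matrix (Fin r) (Fin r) ℝ) (t : ℝ) :
    HasDerivAt (fun s => floquetC A S P s Q) ((Q - P) * gramIntegrand (A - P * S) S t) t :=
  ((hasDerivAt_gram (A - P * S) S t).const_mul (Q - P)).const_add 1

lemma hasDerivAt_floquetFlow {t : ℝ} (hu : IsUnit (floquetC A S P t Q)) :
    HasDerivAt (floquetFlow A S P Q)
      ((A - riccatiFlow A S P Q t * S) * floquetFlow A S P Q t) t := by
  refine ((hasDerivAt_exp (A - P * S) t).mul
    (hasDerivAt_matrix_inv (hasDerivAt_floquetC A S P Q t) hu)).congr_deriv ?_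
  simp only [riccatiFlow, floquetFlow, gramIntegrand]
  noncomm_ring

lemma floquetFlow_zero (A S P Q : Matrix (Fin r) (Fin r) ℝ) : floquetFlow A S P Q 0 = 1 := by
  simp [floquetFlow, floquetC_zero]

lemma isRiccatiSolution_riccatiFlow (hS : S.IsSymm) (hP : P.IsSymm) (hP0 : drift A R S P = 0)
    (hu : ∀ t, 0 ≤ t → IsUnit (floquetC A S P t Q)) :
    IsRiccatiSolution A R S Q (riccatiFlow A S P Q) := by
  refine ⟨by simp [riccatiFlow, floquetFlow_zero], fun t ht => HasDerivAt.hasDerivWithinAt ?_⟩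
  have h := (((hasDerivAt_floquetFlow (hu t ht)).mul_const (Q - P)).mul
    (hasDerivAt_exp_smul_const (A - P * S)ᵀ t)).const_add P
  refine h.congr_deriv ?_
  have h1 := drift_sub_drift (A := A) (R := R) (X := riccatiFlow A S P Q t) hP hS
  rw [hP0, sub_zero] at h1
  have h2 : riccatiFlow A S P Q t - P
      = floquetFlow A S P Q t * (Q - P) * NormedSpace.exp (t • (A - P * S)ᵀ) := by
    rw [riccatiFlow, add_sub_cancel_left]
  have h3 : Commute (A - P * S)ᵀ (NormedSpace.exp (t • (A - P * S)ᵀ)) :=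
    ((Commute.refl _).smul_right t).exp_right
  rw [h1, h2]
  simp only [mul_assoc]

/-- Uniqueness for the linear equation `D' = L D + D K` with continuous coefficients. -/
lemma eq_zero_of_linear_ode {L K D : ℝ → Matrix (Fin r) (Fin r) ℝ}
    (hL : ContinuousOn L (Ici 0)) (hK : ContinuousOn K (Ici 0)) (h0 : D 0 = 0)
    (hD : ∀ t, 0 ≤ t → HasDerivWithinAt D (L t * D t + D t * K t) (Ici 0) t) {T : ℝ} (hT : 0 ≤ T) :
    D T = 0 := by
  obtain ⟨a, ha⟩ := isCompact_Icc.exists_bound_of_continuousOn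
    (hL.mono (Icc_subset_Ici_self : Icc 0 T ⊆ Ici 0))
  obtain ⟨b, hb⟩ := isCompact_Icc.exists_bound_of_continuousOn
    (hK.mono (Icc_subset_Ici_self : Icc 0 T ⊆ Ici 0))
  have hLip : ∀ t ∈ Ico 0 T, LipschitzOnWith (Real.toNNReal (a + b))
      (fun X => L t * X + X * K t) univ := by
    intro t ht
    refine LipschitzOnWith.of_dist_le_mul fun X _ Y _ => ?_
    have h1 := ha t (Ico_subset_Icc_self ht)
    have h2 := hb t (Ico_subset_Icc_self ht)
    have h3 : 0 ≤ a + b := add_nonneg ((norm_nonneg _).trans h1) ((norm_nonneg _).trans h2)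
    rw [Real.coe_toNNReal _ h3, dist_eq_norm, dist_eq_norm]
    have h4 : L t * X + X * K t - (L t * Y + Y * K t) = L t * (X - Y) + (X - Y) * K t := by
      noncomm_ring
    rw [h4, add_mul]
    refine (norm_add_le _ _).trans (add_le_add ?_ ?_)
    · exact (norm_mul_le _ _).trans (mul_le_mul_of_nonneg_right h1 (norm_nonneg _))
    · refine (norm_mul_le _ _).trans ?_
      rw [mul_comm]
      exact mul_le_mul_of_nonneg_right h2 (norm_nonneg _)
  refine ODE_solution_unique_of_mem_Icc_right (g := fun _ => 0) hLip
    (fun t ht => ((hD t ht.1).continuousWithinAt.mono Icc_subset_Ici_self))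
    (fun t ht => (hD t ht.1).mono (Ici_subset_Ici.2 ht.1)) (fun _ _ => trivial)
    continuousOn_const (fun t _ => ?_) (fun _ _ => trivial) h0 ⟨hT, le_rfl⟩
  simpa using hasDerivWithinAt_const t (Ici t) (0 : Matrix (Fin r) (Fin r) ℝ)

lemma IsRiccatiSolution.continuousOn {φ : ℝ → Matrix (Fin r) (Fin r) ℝ}
    (h : IsRiccatiSolution A R S Q φ) : ContinuousOn φ (Ici 0) :=
  fun t ht => (h.2 t ht).continuousWithinAt

lemma IsRiccatiSolution.eqOn {φ ψ : ℝ → Matrix (Fin r) (Fin r) ℝ}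
    (hφ : IsRiccatiSolution A R S Q φ) (hψ : IsRiccatiSolution A R S Q ψ) :
    EqOn φ ψ (Ici 0) := by
  intro T hT
  refine sub_eq_zero.1 (eq_zero_of_linear_ode (L := fun t => A - φ t * S)
    (K := fun t => Aᵀ - S * ψ t) (D := fun t => φ t - ψ t)
    (continuousOn_const.sub (hφ.continuousOn.mul continuousOn_const))
    (continuousOn_const.sub (continuousOn_const.mul hψ.continuousOn)) ?_ (fun t ht => ?_) hT)
  · simp [hφ.1, hψ.1]
  · refine ((hφ.2 t ht).sub (hψ.2 t ht)).congr_deriv ?_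
    simp only [drift]
    noncomm_ring

lemma isUnit_floquetFlow {t : ℝ} (hu : IsUnit (floquetC A S P t Q)) :
    IsUnit (floquetFlow A S P Q t) :=
  (Matrix.isUnit_exp _).mul ((Matrix.isUnit_nonsing_inv_iff).2 hu)

lemma isTransitionMatrix_floquetFlow {φ : ℝ → Matrix (Fin r) (Fin r) ℝ}
    (hφ : EqOn φ (riccatiFlow A S P Q) (Ici 0))
    (hu : ∀ t, 0 ≤ t → IsUnit (floquetC A S P t Q)) :
    IsTransitionMatrix A S φ
      (fun s t => floquetFlow A S P Q t * (floquetFlow A S P Q s)⁻¹) := by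
  have hcancel : ∀ s, 0 ≤ s → floquetFlow A S P Q s * (floquetFlow A S P Q s)⁻¹ = 1 :=
    fun s hs => Matrix.mul_nonsing_inv _
      ((Matrix.isUnit_iff_isUnit_det _).1 (isUnit_floquetFlow (hu s hs)))
  refine ⟨hcancel, fun s t hs hst => HasDerivAt.hasDerivWithinAt ?_,
    fun s t hs hst => HasDerivAt.hasDerivWithinAt ?_⟩
  · have ht := hs.trans hst
    rw [hφ ht, ← mul_assoc]
    exact (hasDerivAt_floquetFlow (hu t ht)).mul_const _
  · rw [hφ hs]
    refine ((hasDerivAt_matrix_inv (hasDerivAt_floquetFlow (hu s hs))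
      (isUnit_floquetFlow (hu s hs))).const_mul (floquetFlow A S P Q t)).congr_deriv ?_
    rw [← mul_assoc (floquetFlow A S P Q s)⁻¹, mul_assoc _ (floquetFlow A S P Q s),
      hcancel s hs, mul_one, mul_neg, mul_assoc]

lemma transition_eq_floquetFlow {φ : ℝ → Matrix (Fin r) (Fin r) ℝ}
    {E : ℝ → ℝ → Matrix (Fin r) (Fin r) ℝ} (hφc : ContinuousOn φ (Ici 0))
    (hφ : EqOn φ (riccatiFlow A S P Q) (Ici 0))
    (hu : ∀ t, 0 ≤ t → IsUnit (floquetC A S P t Q)) (hE : IsTransitionMatrix A S φ E) {t : ℝ}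
    (ht : 0 ≤ t) : E 0 t = floquetFlow A S P Q t := by
  refine sub_eq_zero.1 (eq_zero_of_linear_ode (L := fun t => A - φ t * S) (K := fun _ => 0)
    (D := fun t => E 0 t - floquetFlow A S P Q t)
    (continuousOn_const.sub (hφc.mul continuousOn_const)) continuousOn_const ?_
    (fun s hs => ?_) ht)
  · simp [hE.1 0 le_rfl, floquetFlow_zero]
  · refine ((hE.2.1 0 s le_rfl hs).sub
      (hasDerivAt_floquetFlow (hu s hs)).hasDerivWithinAt).congr_deriv ?_
    rw [hφ hs, mul_zero, add_zero, mul_sub]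

end Riccati

theorem mainTheorem1 (r : ℕ) (hr : 1 ≤ r)
    (A R S Rhalf Shalf : Matrix (Fin r) (Fin r) ℝ)
    (hR : R.PosSemidef) (hS : S.PosSemidef)
    (hRhalf : IsSymmSqrt R Rhalf) (hShalf : IsSymmSqrt S Shalf)
    (hobs : IsObservable A Shalf) (hcon : IsControllable A Rhalf) :
    ∃ P : Matrix (Fin r) (Fin r) ℝ,
      -- `P` is the unique stabilizing fixed point
      IsStabilizingFixedPoint A R S P ∧
      (∀ P' : Matrix (Fin r) (Fin r) ℝ, IsStabilizingFixedPoint A R S P' → P' = P) ∧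
      -- the Gramians and their limit
      (∀ t : ℝ, 0 < t → (gram (A - P * S) S t).PosDef) ∧
      Tendsto (gram (A - P * S) S) atTop (𝓝 (gramInf (A - P * S) S)) ∧
      (gramInf (A - P * S) S).PosDef ∧
      -- the unique negative definite fixed point
      (-negPoint A S P).PosDef ∧ drift A R S (negPoint A S P) = 0 ∧
      (∀ N : Matrix (Fin r) (Fin r) ℝ,
        (-N).PosDef → drift A R S N = 0 → N = negPoint A S P) ∧
      (∀ t : ℝ, 0 ≤ t → floquetC A S P t P = 1) ∧
      ∀ Q : Matrix (Fin r) (Fin r) ℝ, Q.PosSemidef →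
        (∀ t : ℝ, 0 ≤ t → IsUnit (floquetC A S P t Q)) ∧
        (∀ t : ℝ, 0 < t → floquetC A S P t Q =
          (((gram (A - P * S) S t)⁻¹ - (gramInf (A - P * S) S)⁻¹) + (Q - negPoint A S P))
            * gram (A - P * S) S t) ∧
        -- uniform estimates of the inverse
        (∀ δ : ℝ, 0 < δ → ∀ t : ℝ, δ ≤ t → ‖(floquetC A S P t Q)⁻¹‖ ≤ chiDelta A S P δ) ∧
        (∀ t : ℝ, 0 ≤ t → ‖(floquetC A S P t Q)⁻¹‖ ≤ chi A S P Q) ∧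
        -- the Riccati flow started at `Q` is well defined
        (∃ φ : ℝ → Matrix (Fin r) (Fin r) ℝ, IsRiccatiSolution A R S Q φ) ∧
        (∀ φ ψ : ℝ → Matrix (Fin r) (Fin r) ℝ, IsRiccatiSolution A R S Q φ →
          IsRiccatiSolution A R S Q ψ → EqOn φ ψ (Ici 0)) ∧
        -- its transition matrices exist, have the closed form, and obey the uniform bounds
        ∀ φ : ℝ → Matrix (Fin r) (Fin r) ℝ, IsRiccatiSolution A R S Q φ →
          (∃ E : ℝ → ℝ → Matrix (Fin r) (Fin r) ℝ, IsTransitionMatrix A S φ E) ∧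
          ∀ E : ℝ → ℝ → Matrix (Fin r) (Fin r) ℝ, IsTransitionMatrix A S φ E →
            (∀ t : ℝ, 0 ≤ t →
              E 0 t = NormedSpace.exp (t • (A - P * S)) * (floquetC A S P t Q)⁻¹) ∧
            (∀ δ : ℝ, 0 < δ → ∀ t : ℝ, δ ≤ t →
              ‖E 0 t‖ ≤ chiDelta A S P δ * ‖NormedSpace.exp (t • (A - P * S))‖) ∧
            (∀ t : ℝ, 0 ≤ t →
              ‖E 0 t‖ ≤ chi A S P Q * ‖NormedSpace.exp (t • (A - P * S))‖) := by
  have hO := ObservablePair.of_isObservable hShalf hobs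
  have hC := ObservablePair.of_isControllable hRhalf hcon
  obtain ⟨P, hP, hP0⟩ := exists_stabilizing hR hS hO hC
  have hPs := symm_of_posSemidef hP.posSemidef
  have hstab := expStable_of_drift_eq_zero hC hR hS hP hP0
  have hN := posDef_neg_negPoint hR hS hO hC hPs hP0 hstab
  have hN0 := drift_negPoint hS hO hPs hP0 hstab
  refine ⟨P, ⟨hP, hP0, hstab.isHurwitz⟩,
    fun P' hP' => eq_of_drift_eq_zero hC hR hS hP'.1 hP hP'.2.1 hP0,
    fun t ht => posDef_gram_closedLoop hS hO P ht, hstab.tendsto_gram S,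
    posDef_gramInf_closedLoop hS hO hstab, hN, hN0,
    fun N hN' hN0' => eq_of_drift_eq_zero_of_neg hC hR hS hN' hN hN0' hN0,
    fun t _ => by simp [floquetC], fun Q hQ => ?_⟩
  have hu : ∀ t, 0 ≤ t → IsUnit (floquetC A S P t Q) := fun t ht =>
    isUnit_floquetC hS hO hstab hN hQ ht
  have hδ : ∀ δ : ℝ, 0 < δ → ∀ t : ℝ, δ ≤ t → ‖(floquetC A S P t Q)⁻¹‖ ≤ chiDelta A S P δ :=
    fun δ hδ t ht => norm_floquetC_inv_le_chiDelta hr hS hO hstab hN hQ hδ ht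
  have hχ : ∀ t : ℝ, 0 ≤ t → ‖(floquetC A S P t Q)⁻¹‖ ≤ chi A S P Q :=
    fun t ht => norm_floquetC_inv_le_chi hr hS hO hP.posSemidef hstab hN hQ ht
  have hsol : IsRiccatiSolution A R S Q (riccatiFlow A S P Q) :=
    isRiccatiSolution_riccatiFlow (symm_of_posSemidef hS) hPs hP0 hu
  refine ⟨hu, fun t ht => floquetC_eq hS hO P Q ht, hδ, hχ, ⟨_, hsol⟩,
    fun φ ψ hφ hψ => hφ.eqOn hψ, fun φ hφ => ?_⟩
  have hφ' : EqOn φ (riccatiFlow A S P Q) (Ici 0) := hφ.eqOn hsol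
  refine ⟨⟨_, isTransitionMatrix_floquetFlow hφ' hu⟩, fun E hE => ?_⟩
  have hE' : ∀ t : ℝ, 0 ≤ t →
      E 0 t = NormedSpace.exp (t • (A - P * S)) * (floquetC A S P t Q)⁻¹ :=
    fun t ht => transition_eq_floquetFlow hφ.continuousOn hφ' hu hE ht
  refine ⟨hE', fun δ hδ0 t ht => ?_, fun t ht => ?_⟩
  · rw [hE' t (hδ0.le.trans ht), mul_comm (chiDelta A S P δ)]
    exact (norm_mul_le _ _).trans (mul_le_mul_of_nonneg_left (hδ δ hδ0 t ht) (norm_nonneg _))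
  · rw [hE' t ht, mul_comm (chi A S P Q)]
    exact (norm_mul_le _ _).trans (mul_le_mul_of_nonneg_left (hχ t ht) (norm_nonneg _))
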